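/- Let $n,m\ge 0$ and $T\ge 1$ be integers, let $A_k\in\mathbb R^{n\times n}$, $B_k\in\mathbb R^{n\times m}$ and symmetric $\Sigma_{\rho_k}\succ 0$ in $\mathbb R^{m\times m}$ be given for $k=0,\dots,T-1$, and let $\Sigma_{\mathrm{ini}},\Sigma_{\mathrm{fin}}\succ0$ be symmetric $n\times n$ matrices. Fix the prior $\rho_k=\mathcal N(0,\Sigma_{\rho_k})$, $k=0,\dots,T-1$. A policy $\pi=(\pi_k)_{k=0}^{T-1}$ consists of conditional probability densities $\pi_k(\cdot\mid x)$ on $\mathbb R^m$ given $x\in\mathbb R^n$. Consider the problem $$\min_\pi\ \mathbb E\Big[\sum_{k=0}^{T-1}\Big(\tfrac12\|u_k\|^2+\mathcal D_{\mathrm{KL}}[\pi_k(\cdot\mid x_k)\,\|\,\rho_k]\Big)\Big]$$ subject to $x_{k+1}=A_kx_k+B_ku_k$, $u_k\sim\pi_k(\cdot\mid x_k)$ given $x_k$, $x_0\sim\mathcal N(0,\Sigma_{\mathrm{ini}})$ and $x_T\sim\mathcal N(0,\Sigma_{\mathrm{fin}})$. Put $\bar B_k=B_k(\Sigma_{\rho_k}^{-1}+I)^{-1/2}$.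 Let $\Phi(k,l)=A_{k-1}\cdots A_l$ for $k>l$, $\Phi(k,k)=I$, $\Phi(k,l)=A_k^{-1}\cdots A_{l-1}^{-1}$ for $k<l$, and $$G_r(k_1,k_0)=\sum_{k=k_0}^{k_1-1}\Phi(k_1,k+1)\bar B_k\bar B_k^\top\Phi(k_1,k+1)^\top,\qquad G_c(k_1,k_0)=\sum_{k=k_0}^{k_1-1}\Phi(k_0,k+1)\bar B_k\bar B_k^\top\Phi(k_0,k+1)^\top .$$ Assume that every $A_k$, $0\le k\le T-1$, is invertible, and that there is $k_r\in\{1,\dots,T\}$ such that $G_r(k,0)$ is invertible for all $k\in\{k_r,\dots,T\}$ and $G_r(T,k)$ is invertible for all $k\in\{0,\dots,k_r-1\}$. With $G=G_c(T,0)$, $S_0=G^{-1/2}\Sigma_{\mathrm{ini}}G^{-1/2}$ and $S_T=G^{-1/2}\Phi(0,T)\Sigma_{\mathrm{fin}}\Phi(0,T)^\top G^{-1/2}$, assume further that the two matrices $$\mathcal F=S_0+\tfrac12I-\big(S_0^{1/2}S_TS_0^{1/2}+\tfrac14I\big)^{1/2},\qquad -S_0+\tfrac12I+\big(S_0^{1/2}S_TS_0^{1/2}+\tfrac14I\big)^{1/2}$$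 are invertible. Let $Q_k$, $0\le k\le T$, be the solution of $$Q_{k+1}=A_kQ_kA_k^\top-\bar B_k\bar B_k^\top,\qquad Q_0=G^{1/2}S_0^{1/2}\mathcal F^{-1}S_0^{1/2}G^{1/2}.$$ Then all $Q_k$, $0\le k\le T$, are invertible, $\Sigma_{\rho_k}^{-1}+I+B_k^\top Q_{k+1}^{-1}B_k\succ0$ for $0\le k\le T-1$, and the problem has a unique optimal policy, with finite optimal value, namely $$\pi_k(\cdot\mid x)=\mathcal N\big(-\Sigma_kB_k^\top Q_{k+1}^{-1}A_kx,\ \Sigma_k\big),\qquad \Sigma_k=\big(\Sigma_{\rho_k}^{-1}+I+B_k^\top Q_{k+1}^{-1}B_k\big)^{-1},\qquad 0\le k\le T-1.$$ Uniqueness means that every optimal policy $\pi'$ satisfies $\pi'_k(\cdot\mid x)=\pi_k(\cdot\mid x)$ as distributions for every $k\in\{0,\dots,T-1\}$ and Lebesgue-almost every $x\in\mathbb R^n$. -/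

import Mathlib

open scoped MatrixOrder Matrix ENNReal
open MeasureTheory ProbabilityTheory

noncomputable section

namespace MIDensityControl

/-- Euclidean space `ℝⁿ` (with the Euclidean norm). -/
abbrev Vec (n : ℕ) : Type := EuclideanSpace ℝ (Fin n)

/-- A family of stochastic policies: `π k x` is the law of the input `u_k` given `x_k = x`. -/
abbrev PolicyFamily (n m : ℕ) : Type := ℕ → Kernel (Vec n) (Vec m)

variable {n m : ℕ}

/-- One step of the linear system, `(x, u) ↦ A x + B u`. -/
def step (A : Matrix (Fin n) (Fin n) ℝ) (B : Matrix (Fin n) (Fin m) ℝ)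
    (p : Vec n × Vec m) : Vec n :=
  Matrix.toEuclideanLin A p.1 + Matrix.toEuclideanLin B p.2

/-- The law of the state `x_k` under `x_0 ∼ N(0, Σ_ini)`, `x_{k+1} = A_k x_k + B_k u_k`,
`u_k ∼ π_k(· | x_k)`; the joint law of `(x_k, u_k)` is `(law of x_k) ⊗ₘ π_k`. -/
def stateLaw (A : ℕ → Matrix (Fin n) (Fin n) ℝ) (B : ℕ → Matrix (Fin n) (Fin m) ℝ)
    (Sini : Matrix (Fin n) (Fin n) ℝ) (π : PolicyFamily n m) : ℕ → Measure (Vec n)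
  | 0 => multivariateGaussian 0 Sini
  | k + 1 => ((stateLaw A B Sini π k) ⊗ₘ (π k)).map (step (A k) (B k))

/-- The family `(π_0, …, π_{T-1})` is a policy: each `π_k(· | x)` is a probability distribution
on `ℝᵐ` that has a density with respect to Lebesgue measure. Only `k < T` matters. -/
def IsPolicy (T : ℕ) (π : PolicyFamily n m) : Prop :=
  ∀ k < T, IsMarkovKernel (π k) ∧ ∀ x, π k x ≪ (volume : Measure (Vec m))

/-- The objective `J(π, ρ) = E[∑_{k<T} ½‖u_k‖² + KL(π_k(· | x_k) ‖ ρ_k)]`. All terms are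
nonnegative, so the expectation is taken in `[0, ∞]`. -/
def cost (T : ℕ) (A : ℕ → Matrix (Fin n) (Fin n) ℝ) (B : ℕ → Matrix (Fin n) (Fin m) ℝ)
    (Sini : Matrix (Fin n) (Fin n) ℝ) (ρ : ℕ → Measure (Vec m)) (π : PolicyFamily n m) : ℝ≥0∞ :=
  ∑ k ∈ Finset.range T,
    ∫⁻ p, (ENNReal.ofReal (‖p.2‖ ^ 2 / 2) + InformationTheory.klDiv (π k p.1) (ρ k))
      ∂((stateLaw A B Sini π k) ⊗ₘ (π k))

/-- Feasibility: `π` is a policy that steers the state to `x_T ∼ N(0, Σ_fin)`. -/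
def IsFeasible (T : ℕ) (A : ℕ → Matrix (Fin n) (Fin n) ℝ) (B : ℕ → Matrix (Fin n) (Fin m) ℝ)
    (Sini Sfin : Matrix (Fin n) (Fin n) ℝ) (π : PolicyFamily n m) : Prop :=
  IsPolicy T π ∧ stateLaw A B Sini π T = multivariateGaussian 0 Sfin

/-- `π` solves the MI optimal density control problem with the prior `ρ` fixed. -/
def IsOptimal (T : ℕ) (A : ℕ → Matrix (Fin n) (Fin n) ℝ) (B : ℕ → Matrix (Fin n) (Fin m) ℝ)
    (Sini Sfin : Matrix (Fin n) (Fin n) ℝ) (ρ : ℕ → Measure (Vec m)) (π : PolicyFamily n m) :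
    Prop :=
  IsFeasible T A B Sini Sfin π ∧
    ∀ π' : PolicyFamily n m, IsFeasible T A B Sini Sfin π' →
      cost T A B Sini ρ π ≤ cost T A B Sini ρ π'

/-- The Gaussian prior `ρ_k = N(0, Σ_{ρ_k})`. -/
def gaussianPrior (Sρ : ℕ → Matrix (Fin m) (Fin m) ℝ) (k : ℕ) : Measure (Vec m) :=
  multivariateGaussian 0 (Sρ k)

/-- `forwardProd A l j = A_{l+j-1} ⋯ A_{l+1} A_l`. -/
def forwardProd (A : ℕ → Matrix (Fin n) (Fin n) ℝ) (l : ℕ) : ℕ → Matrix (Fin n) (Fin n) ℝ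
  | 0 => 1
  | j + 1 => A (l + j) * forwardProd A l j

/-- `backwardProd A k j = A_k⁻¹ A_{k+1}⁻¹ ⋯ A_{k+j-1}⁻¹`. -/
def backwardProd (A : ℕ → Matrix (Fin n) (Fin n) ℝ) (k : ℕ) : ℕ → Matrix (Fin n) (Fin n) ℝ
  | 0 => 1
  | j + 1 => backwardProd A k j * (A (k + j))⁻¹

/-- The state-transition matrix `Φ(k, l)`. -/
def Phi (A : ℕ → Matrix (Fin n) (Fin n) ℝ) (k l : ℕ) : Matrix (Fin n) (Fin n) ℝ :=
  if l ≤ k then forwardProd A l (k - l) else backwardProd A k (l - k)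

/-- The reachability Gramian `G_r(k₁, k₀)`. -/
def reachGramian (A : ℕ → Matrix (Fin n) (Fin n) ℝ) (Bbar : ℕ → Matrix (Fin n) (Fin m) ℝ)
    (k₁ k₀ : ℕ) : Matrix (Fin n) (Fin n) ℝ :=
  ∑ k ∈ Finset.Ico k₀ k₁, Phi A k₁ (k + 1) * Bbar k * (Bbar k)ᵀ * (Phi A k₁ (k + 1))ᵀ

/-- The controllability Gramian `G_c(k₁, k₀)`. -/
def ctrlGramian (A : ℕ → Matrix (Fin n) (Fin n) ℝ) (Bbar : ℕ → Matrix (Fin n) (Fin m) ℝ)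
    (k₁ k₀ : ℕ) : Matrix (Fin n) (Fin n) ℝ :=
  ∑ k ∈ Finset.Ico k₀ k₁, Phi A k₀ (k + 1) * Bbar k * (Bbar k)ᵀ * (Phi A k₀ (k + 1))ᵀ

/-- `B_k^ρ = B_k (Σ_{ρ_k}⁻¹ + I)^{-1/2}`; `CFC.sqrt` is the positive semidefinite square root. -/
def scaledInput (B : ℕ → Matrix (Fin n) (Fin m) ℝ) (Sρ : ℕ → Matrix (Fin m) (Fin m) ℝ) (k : ℕ) :
    Matrix (Fin n) (Fin m) ℝ :=
  B k * (CFC.sqrt ((Sρ k)⁻¹ + 1))⁻¹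

/-- `S₀ = G^{-1/2} Σ_ini G^{-1/2}`, where `G = G_c(T, 0)`. -/
def S0 (T : ℕ) (A : ℕ → Matrix (Fin n) (Fin n) ℝ) (Bbar : ℕ → Matrix (Fin n) (Fin m) ℝ)
    (Sini : Matrix (Fin n) (Fin n) ℝ) : Matrix (Fin n) (Fin n) ℝ :=
  (CFC.sqrt (ctrlGramian A Bbar T 0))⁻¹ * Sini * (CFC.sqrt (ctrlGramian A Bbar T 0))⁻¹

/-- `S_T = G^{-1/2} Φ(0, T) Σ_fin Φ(0, T)ᵀ G^{-1/2}`, where `G = G_c(T, 0)`. -/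
def ST (T : ℕ) (A : ℕ → Matrix (Fin n) (Fin n) ℝ) (Bbar : ℕ → Matrix (Fin n) (Fin m) ℝ)
    (Sfin : Matrix (Fin n) (Fin n) ℝ) : Matrix (Fin n) (Fin n) ℝ :=
  (CFC.sqrt (ctrlGramian A Bbar T 0))⁻¹ * (Phi A 0 T * Sfin * (Phi A 0 T)ᵀ) *
    (CFC.sqrt (ctrlGramian A Bbar T 0))⁻¹

/-- `(S₀^{1/2} S_T S₀^{1/2} + ¼ I)^{1/2}` for given matrices `S₀`, `S_T`. -/
def rootTerm (S₀ S₁ : Matrix (Fin n) (Fin n) ℝ) : Matrix (Fin n) (Fin n) ℝ :=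
  CFC.sqrt (CFC.sqrt S₀ * S₁ * CFC.sqrt S₀ + (1 / 4 : ℝ) • (1 : Matrix (Fin n) (Fin n) ℝ))

/-- `S₀ + ½ I - (S₀^{1/2} S_T S₀^{1/2} + ¼ I)^{1/2}`. -/
def Fminus (S₀ S₁ : Matrix (Fin n) (Fin n) ℝ) : Matrix (Fin n) (Fin n) ℝ :=
  S₀ + (1 / 2 : ℝ) • (1 : Matrix (Fin n) (Fin n) ℝ) - rootTerm S₀ S₁

/-- `-S₀ + ½ I + (S₀^{1/2} S_T S₀^{1/2} + ¼ I)^{1/2}`. -/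
def Fplus (S₀ S₁ : Matrix (Fin n) (Fin n) ℝ) : Matrix (Fin n) (Fin n) ℝ :=
  -S₀ + (1 / 2 : ℝ) • (1 : Matrix (Fin n) (Fin n) ℝ) + rootTerm S₀ S₁

/-- The initial value `Q₀ = G^{1/2} S₀^{1/2} 𝓕⁻¹ S₀^{1/2} G^{1/2}`, where `G = G_c(T, 0)`. -/
def Qinit (T : ℕ) (A : ℕ → Matrix (Fin n) (Fin n) ℝ) (Bbar : ℕ → Matrix (Fin n) (Fin m) ℝ)
    (Sini Sfin : Matrix (Fin n) (Fin n) ℝ) : Matrix (Fin n) (Fin n) ℝ :=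
  CFC.sqrt (ctrlGramian A Bbar T 0) * CFC.sqrt (S0 T A Bbar Sini) *
    (Fminus (S0 T A Bbar Sini) (ST T A Bbar Sfin))⁻¹ *
    CFC.sqrt (S0 T A Bbar Sini) * CFC.sqrt (ctrlGramian A Bbar T 0)

/-- `Σ_{ρ_k}⁻¹ + I + B_kᵀ Q_{k+1}⁻¹ B_k`, the inverse of the covariance of the optimal policy. -/
def optPrecision (B : ℕ → Matrix (Fin n) (Fin m) ℝ) (Sρ : ℕ → Matrix (Fin m) (Fin m) ℝ)
    (Q : ℕ → Matrix (Fin n) (Fin n) ℝ) (k : ℕ) : Matrix (Fin m) (Fin m) ℝ :=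
  (Sρ k)⁻¹ + 1 + (B k)ᵀ * (Q (k + 1))⁻¹ * B k

end MIDensityControl

end

/-! The proof has a matrix half, which makes the proposed policy well defined and feasible, and a
verification half, which compares it with every other policy.

Matrices. Pulled back to time 0 by the transition matrices, `Q k` is `Q 0 - G_c(k,0)`
(`riccati_eq`), and `G_c(k,0)` lies between `0` and `G`. The definition of `Q 0` gives `G⁻¹ - (Q
0)⁻¹ = E` with `E` congruent to `D = (S₀^{1/2} S_T S₀^{1/2} + ¼I)^{1/2} - ½I`, which is positive
definite. Hence `Q 0 - H` is invertible whenever `0 ≤ H ≤ G` (`isUnit_sub_of_inv_sub_inv_posDef`).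
This yields the invertibility of every `Q k`, and, along the segment `Q (k+1) + t • B̄ B̄ᵀ`, the
positivity of the precision (`one_add_posDef_of_isUnit`). Closed-loop covariances keep the form `Q +
Q Z Q` (`covariance_step`), and `D² + D = S₀^{1/2} S_T S₀^{1/2}` is exactly the terminal condition
(`init_factor`).

Verification. Completing the square (`quadratic_step`) shows that the log-density of the prior minus
that of the Gaussian policy is `½‖u‖²` plus the increment of the potential `½ xᵀ Q⁻¹ x`, up to a
constant (`HasPotential`). Changing the reference measure in the divergence and summing over time,
the potential telescopes to the two prescribed marginals. So for feasible policies of finite cost,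
the cost is a constant plus the expected divergence from the Gaussian policy (`sum_klDiv_eq`). This
is minimal exactly when the divergence vanishes almost surely along the state law, and the optimal
state laws are nondegenerate Gaussians, so "almost surely" means Lebesgue-almost everywhere. -/

noncomputable section

namespace MIDensityControl

/-! ### Invertibility and positivity criteria for real matrices -/

section LinearAlgebra

variable {n m : ℕ}

lemma dotProduct_mulVec_comm {M : Matrix (Fin n) (Fin n) ℝ} (hM : M.IsHermitian)
    (x y : Fin n → ℝ) : x ⬝ᵥ M *ᵥ y = y ⬝ᵥ M *ᵥ x := by
  have h : Mᵀ = M := by simpa [Matrix.IsHermitian] using hM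
  rw [Matrix.dotProduct_mulVec, ← Matrix.mulVec_transpose, h, dotProduct_comm]

lemma posSemidef_mul_transpose (M : Matrix (Fin n) (Fin m) ℝ) : (M * Mᵀ).PosSemidef := by
  simpa using Matrix.posSemidef_self_mul_conjTranspose M

lemma posDef_conj {M : Matrix (Fin n) (Fin n) ℝ} (hM : M.PosDef) {N : Matrix (Fin n) (Fin n) ℝ}
    (hN : IsUnit N) : (N * M * Nᵀ).PosDef := by
  simpa [Matrix.star_eq_conjTranspose] using
    (Matrix.IsUnit.posDef_star_right_conjugate_iff hN).2 hM

lemma posSemidef_conj {M : Matrix (Fin n) (Fin n) ℝ} (hM : M.PosSemidef)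
    (N : Matrix (Fin m) (Fin n) ℝ) : (N * M * Nᵀ).PosSemidef := by
  simpa using hM.mul_mul_conjTranspose_same N

lemma isUnit_of_mulVec_eq_zero {M : Matrix (Fin n) (Fin n) ℝ}
    (h : ∀ v, M *ᵥ v = 0 → v = 0) : IsUnit M := by
  rw [← Matrix.mulVec_injective_iff_isUnit]
  intro v w hvw
  exact sub_eq_zero.1 (h _ (by rw [Matrix.mulVec_sub]; exact sub_eq_zero.2 hvw))

/-- If `G⁻¹ - Q⁻¹` is positive definite, then `Q` dominates no matrix between `0` and `G`
in a singular way. -/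
lemma isUnit_sub_of_inv_sub_inv_posDef {G Q H : Matrix (Fin n) (Fin n) ℝ} (hG : G.PosDef)
    (hQ : IsUnit Q) (hQG : (G⁻¹ - Q⁻¹).PosDef) (hH : H.PosSemidef) (hGH : (G - H).PosSemidef) :
    IsUnit (Q - H) := by
  refine isUnit_of_mulVec_eq_zero fun v hv => ?_
  rw [Matrix.sub_mulVec, sub_eq_zero] at hv
  set w := Q *ᵥ v with hw
  have hvw : Q⁻¹ *ᵥ w = v := by
    rw [hw, Matrix.mulVec_mulVec, Matrix.nonsing_inv_mul _ ((Matrix.isUnit_iff_isUnit_det _).1 hQ),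
      Matrix.one_mulVec]
  set z := G⁻¹ *ᵥ w with hz
  have hGz : G *ᵥ z = w := by
    rw [hz, Matrix.mulVec_mulVec,
      Matrix.mul_nonsing_inv _ ((Matrix.isUnit_iff_isUnit_det _).1 hG.isUnit), Matrix.one_mulVec]
  by_contra hv0
  have hw0 : w ≠ 0 := by
    rintro h0
    exact hv0 (by rw [← hvw, h0, Matrix.mulVec_zero])
  -- With `w = Q v = H v` and `G z = w`, `h1` says `z·w > v·w`. Adding `h2` and `h3` cancels `z·H z`
  -- and leaves `v·w ≥ z·w`.
  have h1 := hQG.dotProduct_mulVec_pos hw0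
  have h2 := hH.dotProduct_mulVec_nonneg (v - z)
  have h3 := hGH.dotProduct_mulVec_nonneg z
  have h4 := dotProduct_mulVec_comm hH.1 v z
  simp only [star_trivial, Matrix.sub_mulVec, Matrix.mulVec_sub, dotProduct_sub, sub_dotProduct,
    hvw, ← hz, hGz, ← hv] at h1 h2 h3 h4
  rw [dotProduct_comm w z, dotProduct_comm w v] at h1
  linarith

lemma posDef_of_eigenvector {M : Matrix (Fin n) (Fin n) ℝ} (hM : M.IsHermitian)
    (h : ∀ (c : ℝ) (v : Fin n → ℝ), v ≠ 0 → M *ᵥ v = c • v → 0 < c) : M.PosDef := by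
  rw [hM.posDef_iff_eigenvalues_pos]
  intro i
  refine h _ (hM.eigenvectorBasis i).ofLp ?_ (hM.mulVec_eigenvectorBasis i)
  intro h0
  exact hM.eigenvectorBasis.toBasis.ne_zero i (by simpa using h0)

/-- An eigenvalue `c ≤ 0` with eigenvector `v` would make `P + t • (b * bᵀ)` annihilate `P⁻¹ b v` at
`t = (1 - c)⁻¹`, which lies in `(0, 1]`. Thus invertibility along the segment replaces any sign
condition on `P`. -/
lemma one_add_posDef_of_isUnit {P : Matrix (Fin n) (Fin n) ℝ} (hP : P.IsHermitian)
    (b : Matrix (Fin n) (Fin m) ℝ)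
    (h : ∀ t : ℝ, 0 ≤ t → t ≤ 1 → IsUnit (P + t • (b * bᵀ))) :
    (1 + bᵀ * P⁻¹ * b).PosDef := by
  have hPu : IsUnit P := by simpa using h 0 le_rfl zero_le_one
  have hPd := (Matrix.isUnit_iff_isUnit_det _).1 hPu
  refine posDef_of_eigenvector ?_ fun c v hv hc => ?_
  · refine Matrix.isHermitian_one.add ?_
    simpa using Matrix.isHermitian_conjTranspose_mul_mul b hP.inv
  by_contra! hc0
  rw [Matrix.add_mulVec, Matrix.one_mulVec] at hc
  have hK : (bᵀ * P⁻¹ * b) *ᵥ v = (c - 1) • v := by rw [sub_smul, one_smul, ← hc]; abel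
  have ht : 0 < 1 - c := by linarith
  have hu := h (1 - c)⁻¹ (by positivity) (inv_le_one_of_one_le₀ (by linarith))
  rw [← Matrix.mulVec_injective_iff_isUnit] at hu
  have hz : P⁻¹ *ᵥ (b *ᵥ v) = 0 := by
    apply hu
    simp only [Matrix.mulVec_zero, Matrix.add_mulVec, Matrix.smul_mulVec, ← Matrix.mulVec_mulVec]
    have e : bᵀ *ᵥ P⁻¹ *ᵥ b *ᵥ v = (c - 1) • v := by
      rw [← hK]; simp only [Matrix.mulVec_mulVec, Matrix.mul_assoc]
    rw [e, Matrix.mulVec_mulVec, Matrix.mul_nonsing_inv _ hPd, Matrix.one_mulVec,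
      Matrix.mulVec_smul, smul_smul]
    have : (1 - c)⁻¹ * (c - 1) = -1 := by field_simp; ring
    rw [this]; simp
  have h0 : (c - 1) • v = 0 := by
    rw [← hK, ← Matrix.mulVec_mulVec, ← Matrix.mulVec_mulVec, hz, Matrix.mulVec_zero]
  rcases smul_eq_zero.1 h0 with h0 | h0
  · linarith
  · exact hv h0

/-- An eigenvalue `c` of `R - ½` gives the eigenvalue `c (c + 1)` of `R² - ¼`; its positivity
together with `c + ½ ≥ 0` forces `c > 0`. -/
lemma sub_half_posDef {R : Matrix (Fin n) (Fin n) ℝ} (hR : R.PosSemidef)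
    (h : (R * R - (1 / 4 : ℝ) • (1 : Matrix (Fin n) (Fin n) ℝ)).PosDef) :
    (R - (1 / 2 : ℝ) • (1 : Matrix (Fin n) (Fin n) ℝ)).PosDef := by
  refine posDef_of_eigenvector ?_ fun c v hv hc => ?_
  · refine hR.1.sub ?_
    simp [Matrix.IsHermitian]
  have hRv : R *ᵥ v = (c + 1 / 2) • v := by
    rw [Matrix.sub_mulVec, Matrix.smul_mulVec, Matrix.one_mulVec] at hc
    rw [add_smul, ← hc]; abel
  have h1 := h.dotProduct_mulVec_pos hv
  have h2 := hR.dotProduct_mulVec_nonneg v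
  have hvv : 0 < v ⬝ᵥ v := by
    simpa using (Matrix.PosDef.one (n := Fin n) (R := ℝ)).dotProduct_mulVec_pos hv
  simp only [star_trivial, Matrix.sub_mulVec, ← Matrix.mulVec_mulVec, hRv, Matrix.mulVec_smul,
    Matrix.smul_mulVec, Matrix.one_mulVec, dotProduct_sub, dotProduct_smul, smul_eq_mul] at h1 h2
  have h3 : 0 ≤ c + 1 / 2 := nonneg_of_mul_nonneg_left h2 hvv
  have h4 : 0 < c * (c + 1) := by
    by_contra! h5
    nlinarith [mul_nonpos_of_nonpos_of_nonneg h5 hvv.le]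
  nlinarith

end LinearAlgebra

/-! ### Riccati algebra of one closed-loop step -/

section Steering

variable {n m : ℕ}

lemma transpose_eq_of_isHermitian {M : Matrix (Fin n) (Fin n) ℝ} (hM : M.IsHermitian) :
    Mᵀ = M := by
  simpa [Matrix.IsHermitian] using hM

lemma transpose_sqrt (M : Matrix (Fin n) (Fin n) ℝ) : (CFC.sqrt M)ᵀ = CFC.sqrt M :=
  transpose_eq_of_isHermitian (Matrix.nonneg_iff_posSemidef.1 (CFC.sqrt_nonneg M)).1

lemma isUnit_det_sqrt {M : Matrix (Fin n) (Fin n) ℝ} (hM : M.PosDef) :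
    IsUnit (CFC.sqrt M).det :=
  (Matrix.isUnit_iff_isUnit_det _).1 ((CFC.isUnit_sqrt_iff M hM.posSemidef.nonneg).2 hM.isUnit)

lemma sqrt_mul_sqrt {M : Matrix (Fin n) (Fin n) ℝ} (hM : M.PosDef) :
    CFC.sqrt M * CFC.sqrt M = M :=
  CFC.sqrt_mul_sqrt_self M hM.posSemidef.nonneg

lemma scaled_mul_transpose {R : Matrix (Fin m) (Fin m) ℝ} (hR : R.PosDef)
    (B : Matrix (Fin n) (Fin m) ℝ) :
    (B * (CFC.sqrt R)⁻¹) * (B * (CFC.sqrt R)⁻¹)ᵀ = B * R⁻¹ * Bᵀ := by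
  conv_rhs => rw [← sqrt_mul_sqrt hR, Matrix.mul_inv_rev]
  rw [Matrix.transpose_mul, Matrix.transpose_nonsing_inv, transpose_sqrt]
  simp only [Matrix.mul_assoc]

/-- Congruence by the square root of `R` reduces this to the case `R = 1`. -/
lemma add_posDef_of_isUnit {P : Matrix (Fin n) (Fin n) ℝ} (hP : P.IsHermitian)
    {R : Matrix (Fin m) (Fin m) ℝ} (hR : R.PosDef) (B : Matrix (Fin n) (Fin m) ℝ)
    (h : ∀ t : ℝ, 0 ≤ t → t ≤ 1 → IsUnit (P + t • (B * R⁻¹ * Bᵀ))) :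
    (R + Bᵀ * P⁻¹ * B).PosDef := by
  have h1 := one_add_posDef_of_isUnit hP (B * (CFC.sqrt R)⁻¹)
    (by rw [scaled_mul_transpose hR]; exact h)
  have hd := isUnit_det_sqrt hR
  have h2 := posDef_conj h1 ((Matrix.isUnit_iff_isUnit_det _).2 hd)
  convert h2 using 1
  rw [Matrix.transpose_mul, Matrix.transpose_nonsing_inv, transpose_sqrt]
  simp only [Matrix.mul_add, Matrix.add_mul, Matrix.mul_assoc, Matrix.mul_one,
    Matrix.mul_nonsing_inv_cancel_left _ _ hd, Matrix.nonsing_inv_mul _ hd, sqrt_mul_sqrt hR]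

/-- The push-through form of Woodbury's identity. -/
lemma mul_inv_mul_transpose_eq {P M : Matrix (Fin n) (Fin n) ℝ} {R : Matrix (Fin m) (Fin m) ℝ}
    {B : Matrix (Fin n) (Fin m) ℝ} (hP : IsUnit P) (hR : IsUnit R) (hM : IsUnit M)
    (hL : IsUnit (R + Bᵀ * P⁻¹ * B)) (hPM : M = P + B * R⁻¹ * Bᵀ) :
    B * (R + Bᵀ * P⁻¹ * B)⁻¹ * Bᵀ = P * M⁻¹ * (M - P) := by
  rw [Matrix.isUnit_iff_isUnit_det] at hP hR hM hL
  have key : M * P⁻¹ * (B * (R + Bᵀ * P⁻¹ * B)⁻¹ * Bᵀ) = M - P := by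
    set L := R + Bᵀ * P⁻¹ * B with hLdef
    have e : Bᵀ * P⁻¹ * B = L - R := by rw [hLdef]; abel
    calc M * P⁻¹ * (B * L⁻¹ * Bᵀ)
        = B * L⁻¹ * Bᵀ + B * R⁻¹ * (Bᵀ * P⁻¹ * B) * L⁻¹ * Bᵀ := by
          rw [hPM, Matrix.add_mul, Matrix.mul_nonsing_inv _ hP, Matrix.add_mul, Matrix.one_mul]
          simp only [Matrix.mul_assoc]
      _ = M - P := by
          rw [e, hPM]
          simp only [Matrix.mul_sub, Matrix.sub_mul, Matrix.mul_assoc,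
            Matrix.nonsing_inv_mul_cancel_left _ _ hR, Matrix.mul_nonsing_inv_cancel_left _ _ hL]
          abel
  rw [← key]
  simp only [Matrix.mul_assoc, Matrix.nonsing_inv_mul_cancel_left _ _ hM,
    Matrix.mul_nonsing_inv_cancel_left _ _ hP]

/-- The product form makes the closed-loop matrix visibly invertible when `A` is, and it turns both
the covariance step and the completion of the square into cancellations. -/
lemma closedLoop_eq {P M A : Matrix (Fin n) (Fin n) ℝ} {R : Matrix (Fin m) (Fin m) ℝ}
    {B : Matrix (Fin n) (Fin m) ℝ} (hP : IsUnit P) (hR : IsUnit R) (hM : IsUnit M)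
    (hL : IsUnit (R + Bᵀ * P⁻¹ * B)) (hPM : M = P + B * R⁻¹ * Bᵀ) :
    A + B * -((R + Bᵀ * P⁻¹ * B)⁻¹ * Bᵀ * P⁻¹ * A) = P * M⁻¹ * A := by
  have h := mul_inv_mul_transpose_eq hP hR hM hL hPM
  rw [Matrix.isUnit_iff_isUnit_det] at hP hM
  have e : B * -((R + Bᵀ * P⁻¹ * B)⁻¹ * Bᵀ * P⁻¹ * A)
      = -((B * (R + Bᵀ * P⁻¹ * B)⁻¹ * Bᵀ) * P⁻¹ * A) := by
    simp only [Matrix.mul_neg, Matrix.mul_assoc]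
  rw [e, h]
  simp only [Matrix.mul_sub, Matrix.sub_mul, Matrix.mul_assoc,
    Matrix.nonsing_inv_mul_cancel_left _ _ hM, Matrix.mul_nonsing_inv_cancel_left _ _ hP]
  abel

/-- One step of the closed-loop covariance recursion. -/
lemma covariance_step {P Q A Z : Matrix (Fin n) (Fin n) ℝ} {R : Matrix (Fin m) (Fin m) ℝ}
    {B : Matrix (Fin n) (Fin m) ℝ} (hP : IsUnit P) (hPs : Pᵀ = P) (hQ : IsUnit Q) (hQs : Qᵀ = Q)
    (hA : IsUnit A) (hR : IsUnit R) (hL : IsUnit (R + Bᵀ * P⁻¹ * B))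
    (hPM : A * Q * Aᵀ = P + B * R⁻¹ * Bᵀ) :
    (A + B * -((R + Bᵀ * P⁻¹ * B)⁻¹ * Bᵀ * P⁻¹ * A)) * (Q + Q * Z * Q) *
        (A + B * -((R + Bᵀ * P⁻¹ * B)⁻¹ * Bᵀ * P⁻¹ * A))ᵀ +
      B * (R + Bᵀ * P⁻¹ * B)⁻¹ * Bᵀ = P + P * (A⁻¹ᵀ * Z * A⁻¹) * P := by
  have hAt : IsUnit Aᵀ := (Matrix.isUnit_transpose A).2 hA
  have hM : IsUnit (A * Q * Aᵀ) := (hA.mul hQ).mul hAt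
  rw [closedLoop_eq hP hR hM hL hPM, mul_inv_mul_transpose_eq hP hR hM hL hPM]
  have hMs : (A * Q * Aᵀ)ᵀ = A * Q * Aᵀ := by
    simp only [Matrix.transpose_mul, Matrix.transpose_transpose, hQs, Matrix.mul_assoc]
  have e : A * (Q + Q * Z * Q) * Aᵀ
      = A * Q * Aᵀ + (A * Q * Aᵀ) * (A⁻¹ᵀ * Z * A⁻¹) * (A * Q * Aᵀ) := by
    have hA' := (Matrix.isUnit_iff_isUnit_det _).1 hA
    have hAt' := (Matrix.isUnit_iff_isUnit_det _).1 hAt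
    rw [Matrix.transpose_nonsing_inv]
    simp only [Matrix.mul_add, Matrix.add_mul, Matrix.mul_assoc,
      Matrix.mul_nonsing_inv_cancel_left _ _ hAt', Matrix.nonsing_inv_mul_cancel_left _ _ hA']
  set M := A * Q * Aᵀ with hMdef
  have hM' := (Matrix.isUnit_iff_isUnit_det _).1 hM
  rw [Matrix.transpose_mul, Matrix.transpose_mul, Matrix.transpose_nonsing_inv, hMs, hPs]
  calc P * M⁻¹ * A * (Q + Q * Z * Q) * (Aᵀ * (M⁻¹ * P)) + P * M⁻¹ * (M - P)
      = P * M⁻¹ * (A * (Q + Q * Z * Q) * Aᵀ) * (M⁻¹ * P) + P * M⁻¹ * (M - P) := by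
        simp only [Matrix.mul_assoc]
    _ = _ := by
        rw [e]
        simp only [Matrix.mul_add, Matrix.add_mul, Matrix.mul_sub, Matrix.mul_assoc,
          Matrix.nonsing_inv_mul_cancel_left _ _ hM', Matrix.mul_nonsing_inv_cancel_left _ _ hM',
          Matrix.nonsing_inv_mul _ hM', Matrix.mul_one]
        abel

/-- Completion of the square in the Bellman recursion. -/
lemma quadratic_step {P Q A : Matrix (Fin n) (Fin n) ℝ} {R : Matrix (Fin m) (Fin m) ℝ}
    {B : Matrix (Fin n) (Fin m) ℝ} (hP : IsUnit P) (hPs : Pᵀ = P) (hQ : IsUnit Q)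
    (hA : IsUnit A) (hR : IsUnit R) (hRs : Rᵀ = R) (hL : IsUnit (R + Bᵀ * P⁻¹ * B))
    (hPM : A * Q * Aᵀ = P + B * R⁻¹ * Bᵀ) (x : Fin n → ℝ) (u : Fin m → ℝ) :
    u ⬝ᵥ R *ᵥ u + (A *ᵥ x + B *ᵥ u) ⬝ᵥ P⁻¹ *ᵥ (A *ᵥ x + B *ᵥ u) =
      (u - (-((R + Bᵀ * P⁻¹ * B)⁻¹ * Bᵀ * P⁻¹ * A)) *ᵥ x) ⬝ᵥ (R + Bᵀ * P⁻¹ * B) *ᵥ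
        (u - (-((R + Bᵀ * P⁻¹ * B)⁻¹ * Bᵀ * P⁻¹ * A)) *ᵥ x) + x ⬝ᵥ Q⁻¹ *ᵥ x := by
  have hAt : IsUnit Aᵀ := (Matrix.isUnit_transpose A).2 hA
  have hM : IsUnit (A * Q * Aᵀ) := (hA.mul hQ).mul hAt
  have hcl := closedLoop_eq (A := A) hP hR hM hL hPM
  set K := -((R + Bᵀ * P⁻¹ * B)⁻¹ * Bᵀ * P⁻¹ * A) with hK
  set L := R + Bᵀ * P⁻¹ * B with hLdef
  rw [Matrix.isUnit_iff_isUnit_det] at hP hL hA hAt hQ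
  have hLs : Lᵀ = L := by
    simp only [hLdef, Matrix.transpose_add, Matrix.transpose_mul, Matrix.transpose_transpose,
      Matrix.transpose_nonsing_inv, hPs, hRs, Matrix.mul_assoc]
  have hPis : P⁻¹ᵀ = P⁻¹ := by rw [Matrix.transpose_nonsing_inv, hPs]
  have hLK : L * K = -(Bᵀ * P⁻¹ * A) := by
    simp only [hK, Matrix.mul_neg, Matrix.mul_assoc, Matrix.mul_nonsing_inv_cancel_left _ _ hL]
  -- The Riccati equation for the inverse: by the closed-loop formula, `Aᵀ P⁻¹ (A + B K) = Aᵀ (A Q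
  -- Aᵀ)⁻¹ A`.
  have hQi : Q⁻¹ = Aᵀ * P⁻¹ * A + Aᵀ * P⁻¹ * B * K := by
    have : Aᵀ * P⁻¹ * A + Aᵀ * P⁻¹ * B * K = Aᵀ * P⁻¹ * (A + B * K) := by
      simp only [Matrix.mul_add, Matrix.mul_assoc]
    rw [this, hcl, Matrix.mul_inv_rev, Matrix.mul_inv_rev]
    simp only [Matrix.mul_assoc, Matrix.nonsing_inv_mul_cancel_left _ _ hP,
      Matrix.mul_nonsing_inv_cancel_left _ _ hAt, Matrix.nonsing_inv_mul _ hA, Matrix.mul_one]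
  have sL := dotProduct_mulVec_comm (M := L) (by simpa [Matrix.IsHermitian] using hLs)
  have sP := dotProduct_mulVec_comm (M := P⁻¹) (by simpa [Matrix.IsHermitian] using hPis)
  have h1 : u ⬝ᵥ L *ᵥ K *ᵥ x = -(u ⬝ᵥ Bᵀ *ᵥ P⁻¹ *ᵥ A *ᵥ x) := by
    rw [Matrix.mulVec_mulVec, hLK]
    simp [Matrix.neg_mulVec, Matrix.mulVec_mulVec, Matrix.mul_assoc]
  have h2 : K *ᵥ x ⬝ᵥ L *ᵥ K *ᵥ x = -(K *ᵥ x ⬝ᵥ Bᵀ *ᵥ P⁻¹ *ᵥ A *ᵥ x) := by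
    rw [Matrix.mulVec_mulVec (M := L), hLK]
    simp [Matrix.neg_mulVec, Matrix.mulVec_mulVec, Matrix.mul_assoc]
  have h3 : x ⬝ᵥ Q⁻¹ *ᵥ x = A *ᵥ x ⬝ᵥ P⁻¹ *ᵥ A *ᵥ x + A *ᵥ x ⬝ᵥ P⁻¹ *ᵥ B *ᵥ K *ᵥ x := by
    rw [hQi]
    simp only [Matrix.add_mulVec, ← Matrix.mulVec_mulVec, dotProduct_add]
    simp only [Matrix.dotProduct_mulVec x Aᵀ, Matrix.vecMul_transpose]
  have h4 : u ⬝ᵥ L *ᵥ u = u ⬝ᵥ R *ᵥ u + B *ᵥ u ⬝ᵥ P⁻¹ *ᵥ B *ᵥ u := by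
    simp only [hLdef, Matrix.add_mulVec, ← Matrix.mulVec_mulVec, dotProduct_add]
    simp only [Matrix.dotProduct_mulVec u Bᵀ, Matrix.vecMul_transpose]
  have h5 : ∀ w : Fin m → ℝ, ∀ y, w ⬝ᵥ Bᵀ *ᵥ y = B *ᵥ w ⬝ᵥ y := by
    intro w y; rw [Matrix.dotProduct_mulVec, Matrix.vecMul_transpose]
  simp only [Matrix.mulVec_sub, Matrix.mulVec_add, dotProduct_sub, sub_dotProduct, dotProduct_add,
    add_dotProduct]
  rw [sL (K *ᵥ x) u, h1, h2, h3, h4, h5, h5, sP (B *ᵥ K *ᵥ x) (A *ᵥ x), sP (B *ᵥ u) (A *ᵥ x)]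
  ring

/-- Since `Q - G = G E Q = Q E G`, the quadratic term is `G E (S - Q) E G`, and `Q - G = G E G + G E
Q E G` absorbs the part with `Q`. In the application the left side is the pulled-back terminal
covariance. -/
lemma terminal_identity {Q G S E : Matrix (Fin n) (Fin n) ℝ} (hQ : IsUnit Q) (hG : IsUnit G)
    (hE : Q⁻¹ = G⁻¹ - E) :
    (Q - G) + (Q - G) * (Q⁻¹ * S * Q⁻¹ - Q⁻¹) * (Q - G) = G * (E * S * E + E) * G := by
  rw [Matrix.isUnit_iff_isUnit_det] at hQ hG
  have hE' : E = G⁻¹ - Q⁻¹ := by rw [hE]; abel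
  rw [hE']
  simp only [Matrix.mul_add, Matrix.add_mul, Matrix.mul_sub, Matrix.sub_mul, Matrix.mul_assoc,
    Matrix.mul_nonsing_inv_cancel_left _ _ hG, Matrix.mul_nonsing_inv_cancel_left _ _ hQ,
    Matrix.nonsing_inv_mul _ hG, Matrix.mul_nonsing_inv _ hG, Matrix.nonsing_inv_mul _ hQ,
    Matrix.mul_nonsing_inv _ hQ, Matrix.mul_one, Matrix.one_mul]
  abel

end Steering

/-! ### Gramians, the Riccati solution and the boundary conditions -/

section Riccati

variable {n m : ℕ}

lemma backwardProd_eq_inv (A : ℕ → Matrix (Fin n) (Fin n) ℝ) (k : ℕ) :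
    backwardProd A 0 k = (forwardProd A 0 k)⁻¹ := by
  induction k with
  | zero => simp [backwardProd, forwardProd]
  | succ k ih => rw [backwardProd, forwardProd, Matrix.mul_inv_rev, ih]

lemma forwardProd_zero_succ (A : ℕ → Matrix (Fin n) (Fin n) ℝ) (k : ℕ) :
    forwardProd A 0 (k + 1) = A k * forwardProd A 0 k := by
  rw [forwardProd, Nat.zero_add]

lemma Phi_zero_left (A : ℕ → Matrix (Fin n) (Fin n) ℝ) (k : ℕ) :
    Phi A 0 k = (forwardProd A 0 k)⁻¹ := by
  rcases Nat.eq_zero_or_pos k with rfl | hk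
  · simp [Phi, forwardProd]
  · rw [Phi, if_neg (by omega), backwardProd_eq_inv, Nat.sub_zero]

lemma forwardProd_mul (A : ℕ → Matrix (Fin n) (Fin n) ℝ) (l j : ℕ) :
    forwardProd A l j * forwardProd A 0 l = forwardProd A 0 (l + j) := by
  induction j with
  | zero => simp [forwardProd]
  | succ j ih =>
    rw [forwardProd, Matrix.mul_assoc, ih, ← Nat.add_assoc, forwardProd, Nat.zero_add]

lemma isUnit_forwardProd {A : ℕ → Matrix (Fin n) (Fin n) ℝ} {T : ℕ} (hA : ∀ k < T, IsUnit (A k))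
    {k : ℕ} (hk : k ≤ T) : IsUnit (forwardProd A 0 k) := by
  induction k with
  | zero => simp [forwardProd]
  | succ k ih =>
    rw [forwardProd_zero_succ]
    exact (hA k hk).mul (ih (by omega))

lemma ctrlGramian_succ (A : ℕ → Matrix (Fin n) (Fin n) ℝ) (Bbar : ℕ → Matrix (Fin n) (Fin m) ℝ)
    (k : ℕ) : ctrlGramian A Bbar (k + 1) 0 = ctrlGramian A Bbar k 0 +
      (forwardProd A 0 (k + 1))⁻¹ * (Bbar k * (Bbar k)ᵀ) * ((forwardProd A 0 (k + 1))⁻¹)ᵀ := by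
  rw [ctrlGramian, Finset.sum_Ico_succ_top (Nat.zero_le k), ← ctrlGramian, Phi_zero_left]
  simp only [Matrix.mul_assoc]

lemma ctrlGramian_sub_posSemidef (A : ℕ → Matrix (Fin n) (Fin n) ℝ)
    (Bbar : ℕ → Matrix (Fin n) (Fin m) ℝ) {k l : ℕ} (hkl : k ≤ l) :
    (ctrlGramian A Bbar l 0 - ctrlGramian A Bbar k 0).PosSemidef := by
  induction l, hkl using Nat.le_induction with
  | base => simpa using Matrix.PosSemidef.zero
  | succ l _ ih =>
    rw [ctrlGramian_succ, add_sub_right_comm]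
    exact ih.add (posSemidef_conj (posSemidef_mul_transpose _) _)

lemma ctrlGramian_posSemidef (A : ℕ → Matrix (Fin n) (Fin n) ℝ)
    (Bbar : ℕ → Matrix (Fin n) (Fin m) ℝ) (k : ℕ) : (ctrlGramian A Bbar k 0).PosSemidef := by
  simpa [ctrlGramian] using ctrlGramian_sub_posSemidef A Bbar (Nat.zero_le k)

/-- The two Gramians over the full horizon are congruent through `Φ(0, T)`. -/
lemma ctrlGramian_posDef {A : ℕ → Matrix (Fin n) (Fin n) ℝ} {Bbar : ℕ → Matrix (Fin n) (Fin m) ℝ}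
    {T : ℕ} (hA : ∀ k < T, IsUnit (A k)) (hG : IsUnit (reachGramian A Bbar T 0)) :
    (ctrlGramian A Bbar T 0).PosDef := by
  rw [(ctrlGramian_posSemidef A Bbar T).posDef_iff_isUnit]
  have hF := isUnit_forwardProd hA le_rfl
  have e : ctrlGramian A Bbar T 0 =
      (forwardProd A 0 T)⁻¹ * reachGramian A Bbar T 0 * ((forwardProd A 0 T)⁻¹)ᵀ := by
    rw [ctrlGramian, reachGramian, Finset.mul_sum, Finset.sum_mul]
    refine Finset.sum_congr rfl fun k hk => ?_
    have hkT : k + 1 ≤ T := (Finset.mem_Ico.1 hk).2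
    have e1 : (forwardProd A 0 T)⁻¹ * Phi A T (k + 1) = Phi A 0 (k + 1) := by
      have h1 := forwardProd_mul A (k + 1) (T - (k + 1))
      rw [Nat.add_sub_cancel' hkT] at h1
      have h2 := (Matrix.isUnit_iff_isUnit_det _).1 (isUnit_forwardProd hA hkT)
      have h3 := (Matrix.isUnit_iff_isUnit_det _).1 hF
      rw [Phi_zero_left, Phi, if_pos hkT]
      calc (forwardProd A 0 T)⁻¹ * forwardProd A (k + 1) (T - (k + 1))
          = (forwardProd A 0 T)⁻¹ * (forwardProd A (k + 1) (T - (k + 1)) *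
              forwardProd A 0 (k + 1)) * (forwardProd A 0 (k + 1))⁻¹ := by
            simp only [Matrix.mul_assoc, Matrix.mul_nonsing_inv _ h2, Matrix.mul_one]
        _ = _ := by rw [h1, Matrix.nonsing_inv_mul _ h3, Matrix.one_mul]
    rw [← e1, Matrix.transpose_mul]
    simp only [Matrix.mul_assoc]
  rw [e]
  have hFi : IsUnit (forwardProd A 0 T)⁻¹ := by simpa using hF
  exact (hFi.mul hG).mul ((Matrix.isUnit_transpose _).2 hFi)

/-- Undoing the dynamics removes the conjugation by `A k`, so each step only subtracts one Gramian
increment. -/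
lemma riccati_eq {A : ℕ → Matrix (Fin n) (Fin n) ℝ} {Bbar : ℕ → Matrix (Fin n) (Fin m) ℝ}
    {T : ℕ} (hA : ∀ k < T, IsUnit (A k)) {Q : ℕ → Matrix (Fin n) (Fin n) ℝ}
    (hQ : ∀ k < T, Q (k + 1) = A k * Q k * (A k)ᵀ - Bbar k * (Bbar k)ᵀ) {k : ℕ} (hk : k ≤ T) :
    Q k = forwardProd A 0 k * (Q 0 - ctrlGramian A Bbar k 0) * (forwardProd A 0 k)ᵀ := by
  induction k with
  | zero => simp [forwardProd, ctrlGramian]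
  | succ k ih =>
    have hF := (Matrix.isUnit_iff_isUnit_det _).1 (isUnit_forwardProd hA hk)
    have hFt : IsUnit ((forwardProd A 0 (k + 1))ᵀ).det := by rwa [Matrix.det_transpose]
    have e : A k * Q k * (A k)ᵀ = forwardProd A 0 (k + 1) * (Q 0 - ctrlGramian A Bbar k 0) *
        (forwardProd A 0 (k + 1))ᵀ := by
      conv_lhs => rw [ih (by omega)]
      rw [forwardProd_zero_succ, Matrix.transpose_mul]
      simp only [Matrix.mul_assoc]
    rw [hQ k hk, e, ctrlGramian_succ]
    simp only [Matrix.mul_add, Matrix.add_mul, Matrix.mul_sub, Matrix.sub_mul, Matrix.mul_assoc,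
      Matrix.transpose_nonsing_inv, Matrix.mul_nonsing_inv_cancel_left _ _ hF,
      Matrix.nonsing_inv_mul _ hFt, Matrix.mul_one]
    abel

/-- Pulled back to time 0 the matrix is `Q 0 - H`, where `H` runs from `G_c(k+1,0)` at `t = 0` to
`G_c(k,0)` at `t = 1`, hence stays between `0` and `G`. The endpoint `t = 0` is the invertibility of
`Q (k+1)`; the whole segment gives the positive precision. -/
lemma isUnit_riccati_add {A : ℕ → Matrix (Fin n) (Fin n) ℝ} {Bbar : ℕ → Matrix (Fin n) (Fin m) ℝ}
    {T : ℕ} (hA : ∀ k < T, IsUnit (A k)) {Q : ℕ → Matrix (Fin n) (Fin n) ℝ}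
    (hQ : ∀ k < T, Q (k + 1) = A k * Q k * (A k)ᵀ - Bbar k * (Bbar k)ᵀ)
    (hG : (ctrlGramian A Bbar T 0).PosDef) (hQ0 : IsUnit (Q 0))
    (hQG : ((ctrlGramian A Bbar T 0)⁻¹ - (Q 0)⁻¹).PosDef) {k : ℕ} (hk : k < T) {t : ℝ}
    (ht0 : 0 ≤ t) (ht1 : t ≤ 1) : IsUnit (Q (k + 1) + t • (Bbar k * (Bbar k)ᵀ)) := by
  have hF := isUnit_forwardProd hA (k := k + 1) hk
  have hF' := (Matrix.isUnit_iff_isUnit_det _).1 hF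
  have hFt : IsUnit ((forwardProd A 0 (k + 1))ᵀ).det := by rwa [Matrix.det_transpose]
  set N := (forwardProd A 0 (k + 1))⁻¹ * (Bbar k * (Bbar k)ᵀ) * ((forwardProd A 0 (k + 1))⁻¹)ᵀ
    with hN
  have hNs : N.PosSemidef := posSemidef_conj (posSemidef_mul_transpose _) _
  have e : Q (k + 1) + t • (Bbar k * (Bbar k)ᵀ) = forwardProd A 0 (k + 1) *
      (Q 0 - (ctrlGramian A Bbar (k + 1) 0 - t • N)) * (forwardProd A 0 (k + 1))ᵀ := by
    rw [riccati_eq hA hQ hk, hN]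
    simp only [Matrix.mul_sub, Matrix.sub_mul, Matrix.mul_assoc, Matrix.mul_smul,
      Matrix.smul_mul, Matrix.transpose_nonsing_inv, Matrix.mul_nonsing_inv_cancel_left _ _ hF',
      Matrix.nonsing_inv_mul _ hFt, Matrix.mul_one]
    abel
  rw [e]
  refine (hF.mul (isUnit_sub_of_inv_sub_inv_posDef hG hQ0 hQG ?_ ?_)).mul
    ((Matrix.isUnit_transpose _).2 hF)
  · have : ctrlGramian A Bbar (k + 1) 0 - t • N = ctrlGramian A Bbar k 0 + (1 - t) • N := by
      rw [ctrlGramian_succ, ← hN, sub_smul, one_smul]; abel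
    rw [this]
    exact (ctrlGramian_posSemidef A Bbar k).add (hNs.smul (by linarith))
  · rw [sub_sub_eq_add_sub, add_sub_right_comm]
    exact (ctrlGramian_sub_posSemidef A Bbar hk).add (hNs.smul ht0)

/-- The algebra behind the choice of the initial value `Q₀`, for factors `g = G^{1/2}` and
`s = S₀^{1/2}`. -/
lemma init_factor {g s S₁ : Matrix (Fin n) (Fin n) ℝ} (hg : IsUnit g) (hgs : gᵀ = g)
    (hs : IsUnit s) (hss : sᵀ = s) (hS₁ : S₁.PosDef) {R : Matrix (Fin n) (Fin n) ℝ}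
    (hR : R.PosSemidef) (hRR : R * R = s * S₁ * s + (1 / 4 : ℝ) • (1 : Matrix (Fin n) (Fin n) ℝ))
    (hF : IsUnit (s * s + (1 / 2 : ℝ) • (1 : Matrix (Fin n) (Fin n) ℝ) - R))
    {Q : Matrix (Fin n) (Fin n) ℝ}
    (hQ : Q = g * s * (s * s + (1 / 2 : ℝ) • (1 : Matrix (Fin n) (Fin n) ℝ) - R)⁻¹ * s * g) :
    IsUnit Q ∧ Qᵀ = Q ∧ ((g * g)⁻¹ - Q⁻¹).PosDef ∧
      (Q - g * g) + (Q - g * g) * (Q⁻¹ * (g * s * s * g) * Q⁻¹ - Q⁻¹) * (Q - g * g)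
        = g * S₁ * g := by
  set D := R - (1 / 2 : ℝ) • (1 : Matrix (Fin n) (Fin n) ℝ) with hD
  have hFD : s * s + (1 / 2 : ℝ) • (1 : Matrix (Fin n) (Fin n) ℝ) - R = s * s - D := by
    rw [hD]; abel
  rw [hFD] at hF hQ
  have hRs : Rᵀ = R := transpose_eq_of_isHermitian hR.1
  have hDs : Dᵀ = D := by
    simp only [hD, Matrix.transpose_sub, Matrix.transpose_smul, Matrix.transpose_one, hRs]
  have hDp : D.PosDef := by
    refine sub_half_posDef hR ?_
    rw [hRR, add_sub_cancel_right]
    simpa only [hss] using posDef_conj hS₁ hs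
  have hgd := (Matrix.isUnit_iff_isUnit_det _).1 hg
  have hsd := (Matrix.isUnit_iff_isUnit_det _).1 hs
  have hFd := (Matrix.isUnit_iff_isUnit_det _).1 hF
  have hQu : IsUnit Q := by
    rw [hQ]
    exact (((hg.mul hs).mul (by simpa using hF)).mul hs).mul hg
  set E := (g⁻¹ * s⁻¹) * D * (s⁻¹ * g⁻¹) with hE
  have hQi : Q⁻¹ = (g * g)⁻¹ - E := by
    rw [hQ]
    simp only [Matrix.mul_inv_rev, Matrix.nonsing_inv_nonsing_inv _ hFd, hE]
    simp only [Matrix.mul_sub, Matrix.sub_mul, Matrix.mul_assoc,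
      Matrix.nonsing_inv_mul_cancel_left _ _ hsd, Matrix.mul_nonsing_inv_cancel_left _ _ hsd]
  refine ⟨hQu, ?_, ?_, ?_⟩
  · rw [hQ]
    simp only [Matrix.transpose_mul, Matrix.transpose_nonsing_inv, Matrix.transpose_sub, hgs, hss,
      hDs, Matrix.mul_assoc]
  · rw [hQi, sub_sub_cancel, hE]
    have hu : IsUnit (g⁻¹ * s⁻¹) := IsUnit.mul (by simpa using hg) (by simpa using hs)
    have := posDef_conj hDp hu
    rwa [Matrix.transpose_mul, Matrix.transpose_nonsing_inv, Matrix.transpose_nonsing_inv, hgs,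
      hss] at this
  · rw [terminal_identity hQu (hg.mul hg) hQi]
    -- Completing the square: `D² + D = (D + ½)² - ¼ = R² - ¼`. The shifts by `½` and `¼` come from
    -- here.
    have hDD : D * D + D = s * S₁ * s := by
      have : D * D + D = R * R - (1 / 4 : ℝ) • (1 : Matrix (Fin n) (Fin n) ℝ) := by
        simp only [hD, Matrix.mul_sub, Matrix.sub_mul, Matrix.mul_smul, Matrix.smul_mul,
          Matrix.mul_one, Matrix.one_mul]
        module
      rw [this, hRR, add_sub_cancel_right]
    calc g * g * (E * (g * s * s * g) * E + E) * (g * g)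
        = g * s⁻¹ * (D * D + D) * s⁻¹ * g := by
          simp only [hE, Matrix.mul_add, Matrix.add_mul, Matrix.mul_assoc,
            Matrix.nonsing_inv_mul_cancel_left _ _ hsd,
            Matrix.mul_nonsing_inv_cancel_left _ _ hsd,
            Matrix.nonsing_inv_mul_cancel_left _ _ hgd,
            Matrix.mul_nonsing_inv_cancel_left _ _ hgd]
      _ = g * S₁ * g := by
          rw [hDD]
          simp only [Matrix.mul_assoc, Matrix.nonsing_inv_mul_cancel_left _ _ hsd,
            Matrix.mul_nonsing_inv_cancel_left _ _ hsd]

/-- The initial value `Q₀` satisfies the two boundary conditions of the covariance steering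
problem in coordinates pulled back to time `0`. -/
lemma Qinit_spec {T : ℕ} {A : ℕ → Matrix (Fin n) (Fin n) ℝ} {Bbar : ℕ → Matrix (Fin n) (Fin m) ℝ}
    {Sini Sfin : Matrix (Fin n) (Fin n) ℝ} (hSini : Sini.PosDef) (hSfin : Sfin.PosDef)
    (hA : ∀ k < T, IsUnit (A k)) (hG : (ctrlGramian A Bbar T 0).PosDef)
    (hF : IsUnit (Fminus (S0 T A Bbar Sini) (ST T A Bbar Sfin)))
    {Q : Matrix (Fin n) (Fin n) ℝ} (hQ : Q = Qinit T A Bbar Sini Sfin) :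
    IsUnit Q ∧ Qᵀ = Q ∧ ((ctrlGramian A Bbar T 0)⁻¹ - Q⁻¹).PosDef ∧
      (Q - ctrlGramian A Bbar T 0) + (Q - ctrlGramian A Bbar T 0) *
        (Q⁻¹ * Sini * Q⁻¹ - Q⁻¹) * (Q - ctrlGramian A Bbar T 0)
        = (forwardProd A 0 T)⁻¹ * Sfin * ((forwardProd A 0 T)⁻¹)ᵀ := by
  have hgd := isUnit_det_sqrt hG
  have hg := (Matrix.isUnit_iff_isUnit_det _).2 hgd
  have hgg := sqrt_mul_sqrt hG
  have hgs := transpose_sqrt (ctrlGramian A Bbar T 0)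
  set g := CFC.sqrt (ctrlGramian A Bbar T 0) with hgdef
  have hgi : IsUnit g⁻¹ := by simpa using hg
  have hgis : g⁻¹ᵀ = g⁻¹ := by rw [Matrix.transpose_nonsing_inv, hgs]
  have hS0 : (S0 T A Bbar Sini).PosDef := by
    simpa only [S0, ← hgdef, hgis] using posDef_conj hSini hgi
  have hFi : IsUnit (forwardProd A 0 T)⁻¹ := by simpa using isUnit_forwardProd hA le_rfl
  have hST : (ST T A Bbar Sfin).PosDef := by
    simpa only [ST, ← hgdef, hgis, Phi_zero_left] using posDef_conj (posDef_conj hSfin hFi) hgi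
  have hs := (Matrix.isUnit_iff_isUnit_det _).2 (isUnit_det_sqrt hS0)
  have hss := sqrt_mul_sqrt hS0
  have hst := transpose_sqrt (S0 T A Bbar Sini)
  have hSini' : Sini = g * CFC.sqrt (S0 T A Bbar Sini) * CFC.sqrt (S0 T A Bbar Sini) * g := by
    rw [Matrix.mul_assoc g, hss, S0, ← hgdef]
    simp only [Matrix.mul_assoc, Matrix.mul_nonsing_inv_cancel_left _ _ hgd,
      Matrix.nonsing_inv_mul _ hgd, Matrix.mul_one]
  have hfin : (forwardProd A 0 T)⁻¹ * Sfin * ((forwardProd A 0 T)⁻¹)ᵀ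
      = g * ST T A Bbar Sfin * g := by
    rw [ST, ← hgdef, Phi_zero_left]
    simp only [Matrix.mul_assoc, Matrix.mul_nonsing_inv_cancel_left _ _ hgd,
      Matrix.nonsing_inv_mul _ hgd, Matrix.mul_one]
  have hpos : (CFC.sqrt (S0 T A Bbar Sini) * ST T A Bbar Sfin * CFC.sqrt (S0 T A Bbar Sini) +
      (1 / 4 : ℝ) • (1 : Matrix (Fin n) (Fin n) ℝ)).PosSemidef := by
    refine Matrix.PosSemidef.add ?_ (Matrix.PosSemidef.one.smul (by norm_num))
    simpa only [hst] using posSemidef_conj hST.posSemidef (CFC.sqrt (S0 T A Bbar Sini))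
  have hRR := CFC.sqrt_mul_sqrt_self _ hpos.nonneg
  have hRp := Matrix.nonneg_iff_posSemidef.1 (CFC.sqrt_nonneg
    (CFC.sqrt (S0 T A Bbar Sini) * ST T A Bbar Sfin * CFC.sqrt (S0 T A Bbar Sini) +
      (1 / 4 : ℝ) • (1 : Matrix (Fin n) (Fin n) ℝ)))
  rw [Qinit] at hQ
  rw [Fminus, rootTerm] at hF hQ
  have key := init_factor hg hgs hs hst hST hRp hRR (by rwa [hss])
    (Q := Q) (by rw [hss]; exact hQ)
  rwa [hgg, ← hSini', ← hfin] at key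

/-- Everything the optimality argument needs to know about the matrices. -/
lemma riccati_spec {T : ℕ} {A : ℕ → Matrix (Fin n) (Fin n) ℝ} {B : ℕ → Matrix (Fin n) (Fin m) ℝ}
    {Sini Sfin : Matrix (Fin n) (Fin n) ℝ} (hSini : Sini.PosDef) (hSfin : Sfin.PosDef)
    {Sρ : ℕ → Matrix (Fin m) (Fin m) ℝ} (hSρ : ∀ k < T, (Sρ k).PosDef)
    {Bbar : ℕ → Matrix (Fin n) (Fin m) ℝ} (hBbar : ∀ k < T, Bbar k = scaledInput B Sρ k)
    (hA : ∀ k < T, IsUnit (A k)) (hG : IsUnit (reachGramian A Bbar T 0))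
    (hF : IsUnit (Fminus (S0 T A Bbar Sini) (ST T A Bbar Sfin)))
    {Q : ℕ → Matrix (Fin n) (Fin n) ℝ} (hQ0 : Q 0 = Qinit T A Bbar Sini Sfin)
    (hQ : ∀ k < T, Q (k + 1) = A k * Q k * (A k)ᵀ - Bbar k * (Bbar k)ᵀ) :
    (∀ k ≤ T, IsUnit (Q k)) ∧ (∀ k ≤ T, (Q k)ᵀ = Q k) ∧
    (∀ k < T, (optPrecision B Sρ Q k).PosDef) ∧
    (∀ k < T, A k * Q k * (A k)ᵀ = Q (k + 1) + B k * ((Sρ k)⁻¹ + 1)⁻¹ * (B k)ᵀ) ∧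
    ∃ X : ℕ → Matrix (Fin n) (Fin n) ℝ, X 0 = Sini ∧ X T = Sfin ∧ (∀ k ≤ T, (X k).PosDef) ∧
      ∀ k < T, X (k + 1) =
        (A k + B k * -((optPrecision B Sρ Q k)⁻¹ * (B k)ᵀ * (Q (k + 1))⁻¹ * A k)) * X k *
          (A k + B k * -((optPrecision B Sρ Q k)⁻¹ * (B k)ᵀ * (Q (k + 1))⁻¹ * A k))ᵀ +
        B k * (optPrecision B Sρ Q k)⁻¹ * (B k)ᵀ := by
  have hG' := ctrlGramian_posDef hA hG
  obtain ⟨hQ0u, hQ0s, hQG, hterm⟩ := Qinit_spec hSini hSfin hA hG' hF hQ0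
  have hRpos : ∀ k < T, ((Sρ k)⁻¹ + 1).PosDef := fun k hk =>
    (hSρ k hk).inv.add_posSemidef Matrix.PosSemidef.one
  have hBB : ∀ k < T, Bbar k * (Bbar k)ᵀ = B k * ((Sρ k)⁻¹ + 1)⁻¹ * (B k)ᵀ := fun k hk => by
    rw [hBbar k hk, scaledInput, scaled_mul_transpose (hRpos k hk)]
  have hU : ∀ k ≤ T, IsUnit (Q k) := by
    rintro (_ | k) hk
    · exact hQ0u
    · simpa using isUnit_riccati_add hA hQ hG' hQ0u hQG hk le_rfl zero_le_one
  have hS : ∀ k ≤ T, (Q k)ᵀ = Q k := by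
    intro k hk
    induction k with
    | zero => exact hQ0s
    | succ k ih =>
      rw [hQ k hk, Matrix.transpose_sub, Matrix.transpose_mul, Matrix.transpose_mul,
        Matrix.transpose_mul, Matrix.transpose_transpose, Matrix.transpose_transpose,
        ih (by omega), Matrix.mul_assoc]
  have hP : ∀ k < T, (optPrecision B Sρ Q k).PosDef := by
    intro k hk
    refine add_posDef_of_isUnit (by simpa [Matrix.IsHermitian] using hS (k + 1) hk)
      (hRpos k hk) (B k) fun t ht0 ht1 => ?_
    rw [← hBB k hk]
    exact isUnit_riccati_add hA hQ hG' hQ0u hQG hk ht0 ht1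
  have hM : ∀ k < T, A k * Q k * (A k)ᵀ = Q (k + 1) + B k * ((Sρ k)⁻¹ + 1)⁻¹ * (B k)ᵀ := by
    intro k hk
    rw [hQ k hk, ← hBB k hk]; abel
  refine ⟨hU, hS, hP, hM, ?_⟩
  -- `C` is the solution of `Q 0 + Q 0 * C * Q 0 = Sini`; transporting it by the inverse transition
  -- matrices is what `covariance_step` prescribes.
  set C := (Q 0)⁻¹ * Sini * (Q 0)⁻¹ - (Q 0)⁻¹ with hC
  set X : ℕ → Matrix (Fin n) (Fin n) ℝ := fun k =>
    Q k + Q k * (((forwardProd A 0 k)⁻¹)ᵀ * C * (forwardProd A 0 k)⁻¹) * Q k with hX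
  have hX0 : X 0 = Sini := by
    have hd := (Matrix.isUnit_iff_isUnit_det _).1 hQ0u
    simp only [hX, hC, forwardProd, inv_one, Matrix.transpose_one, Matrix.one_mul, Matrix.mul_one,
      Matrix.mul_sub, Matrix.sub_mul, Matrix.mul_assoc,
      Matrix.mul_nonsing_inv_cancel_left _ _ hd, Matrix.nonsing_inv_mul _ hd]
    abel
  have hstep : ∀ k < T, X (k + 1) =
        (A k + B k * -((optPrecision B Sρ Q k)⁻¹ * (B k)ᵀ * (Q (k + 1))⁻¹ * A k)) * X k *
          (A k + B k * -((optPrecision B Sρ Q k)⁻¹ * (B k)ᵀ * (Q (k + 1))⁻¹ * A k))ᵀ +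
        B k * (optPrecision B Sρ Q k)⁻¹ * (B k)ᵀ := by
    intro k hk
    have h := covariance_step (Z := ((forwardProd A 0 k)⁻¹)ᵀ * C * (forwardProd A 0 k)⁻¹)
      (hU (k + 1) hk) (hS (k + 1) hk) (hU k hk.le) (hS k hk.le) (hA k hk) (hRpos k hk).isUnit
      (hP k hk).isUnit (hM k hk)
    simp only [hX, optPrecision]
    rw [h, forwardProd_zero_succ, Matrix.mul_inv_rev, Matrix.transpose_mul]
    simp only [Matrix.mul_assoc]
  refine ⟨X, hX0, ?_, ?_, hstep⟩
  · have hFd := (Matrix.isUnit_iff_isUnit_det _).1 (isUnit_forwardProd hA (le_refl T))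
    have hFt : IsUnit ((forwardProd A 0 T)ᵀ).det := by rwa [Matrix.det_transpose]
    have e : X T = forwardProd A 0 T * ((Q 0 - ctrlGramian A Bbar T 0) +
        (Q 0 - ctrlGramian A Bbar T 0) * C * (Q 0 - ctrlGramian A Bbar T 0)) *
          (forwardProd A 0 T)ᵀ := by
      simp only [hX]
      rw [riccati_eq hA hQ le_rfl]
      set Y := Q 0 - ctrlGramian A Bbar T 0
      simp only [Matrix.mul_add, Matrix.add_mul, Matrix.mul_assoc, Matrix.transpose_nonsing_inv,
        Matrix.mul_nonsing_inv_cancel_left _ _ hFt, Matrix.nonsing_inv_mul_cancel_left _ _ hFd]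
    rw [e, hterm]
    simp only [Matrix.mul_assoc, Matrix.transpose_nonsing_inv,
      Matrix.mul_nonsing_inv_cancel_left _ _ hFd, Matrix.nonsing_inv_mul _ hFt, Matrix.mul_one]
  · intro k hk
    induction k with
    | zero => rwa [hX0]
    | succ k ih =>
      rw [hstep k hk]
      refine (posDef_conj (ih (by omega)) ?_).add_posSemidef
        (posSemidef_conj (hP k hk).inv.posSemidef _)
      -- The noise term may be singular, so strict positivity of the covariance is carried by the
      -- invertible closed-loop matrix.
      have hMu : IsUnit (A k * Q k * (A k)ᵀ) :=
        ((hA k hk).mul (hU k (Nat.le_of_lt hk))).mul ((Matrix.isUnit_transpose _).2 (hA k hk))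
      rw [optPrecision, closedLoop_eq (hU (k + 1) hk) (hRpos k hk).isUnit hMu (hP k hk).isUnit
        (hM k hk)]
      exact ((hU (k + 1) hk).mul (by simpa using hMu)).mul (hA k hk)

end Riccati

/-! ### Lebesgue densities of Gaussian measures -/

section GaussianDensity

variable {n m : ℕ}

/-- The quadratic form `x ↦ xᵀ M x` on Euclidean space. -/
def quadForm (M : Matrix (Fin n) (Fin n) ℝ) (x : Vec n) : ℝ :=
  x.ofLp ⬝ᵥ M *ᵥ x.ofLp

lemma quadForm_eq_inner (M : Matrix (Fin n) (Fin n) ℝ) (x : Vec n) :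
    quadForm M x = inner ℝ x (Matrix.toEuclideanCLM (𝕜 := ℝ) M x) :=
  (Matrix.inner_toEuclideanCLM M x x).symm

@[fun_prop]
lemma continuous_quadForm (M : Matrix (Fin n) (Fin n) ℝ) : Continuous (quadForm M) := by
  simp only [funext (quadForm_eq_inner M)]
  fun_prop

lemma abs_quadForm_le (M : Matrix (Fin n) (Fin n) ℝ) (x : Vec n) :
    |quadForm M x| ≤ ‖Matrix.toEuclideanCLM (𝕜 := ℝ) M‖ * ‖x‖ ^ 2 := by
  rw [quadForm_eq_inner]
  calc _ ≤ ‖x‖ * ‖Matrix.toEuclideanCLM (𝕜 := ℝ) M x‖ := abs_real_inner_le_norm _ _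
    _ ≤ ‖x‖ * (‖Matrix.toEuclideanCLM (𝕜 := ℝ) M‖ * ‖x‖) := by
        gcongr; exact ContinuousLinearMap.le_opNorm _ _
    _ = _ := by ring

lemma integrable_quadForm {α : Type*} [MeasurableSpace α] {μ : Measure α}
    (M : Matrix (Fin n) (Fin n) ℝ) {f : α → Vec n} (hf : MemLp f 2 μ) :
    Integrable (fun a => quadForm M (f a)) μ := by
  have h := (memLp_two_iff_integrable_sq_norm hf.1).1 hf
  refine (h.const_mul ‖Matrix.toEuclideanCLM (𝕜 := ℝ) M‖).mono'
    ((continuous_quadForm M).comp_aestronglyMeasurable hf.1) (ae_of_all _ fun a => ?_)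
  exact abs_quadForm_le M (f a)

/-- Both sides have the same characteristic function. The density is written as a single exponential
so that log-densities can later be subtracted. -/
lemma stdGaussian_eq_withDensity (m : ℕ) : ∃ c : ℝ, stdGaussian (Vec m) =
    (volume : Measure (Vec m)).withDensity (fun v => ENNReal.ofReal (Real.exp (c - ‖v‖ ^ 2 / 2))) := by
  have hint : Integrable (fun v : Vec m => Real.exp (-‖v‖ ^ 2 / 2)) := by
    have := (GaussianFourier.integrable_cexp_neg_mul_sq_norm_add (V := Vec m) (b := 1 / 2)
      (by norm_num) 0 0).re
    refine this.congr (ae_of_all _ fun v => ?_)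
    simp only [zero_mul, add_zero]
    rw [← RCLike.ofReal_re (K := ℂ) (Real.exp (-‖v‖ ^ 2 / 2))]
    congr 1
    simp only [Complex.coe_algebraMap, Complex.ofReal_exp]
    congr 1
    push_cast
    ring
  set Z : ℝ := ∫ v : Vec m, Real.exp (-‖v‖ ^ 2 / 2) with hZ
  have hZpos : 0 < Z := integral_exp_pos hint
  have hker : ∀ t : Vec m, ∫ v : Vec m, Complex.exp (inner ℝ v t * Complex.I) *
      (Real.exp (-‖v‖ ^ 2 / 2) : ℂ) = Z * Complex.exp (-‖t‖ ^ 2 / 2) := by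
    have h1 : ∀ t : Vec m, ∫ v : Vec m, Complex.exp (inner ℝ v t * Complex.I) *
        (Real.exp (-‖v‖ ^ 2 / 2) : ℂ) =
        (Real.pi / (1 / 2 : ℂ)) ^ (Module.finrank ℝ (Vec m) / 2 : ℂ) *
          Complex.exp (-‖t‖ ^ 2 / 2) := by
      intro t
      have := GaussianFourier.integral_cexp_neg_mul_sq_norm_add (V := Vec m) (b := 1 / 2)
        (by norm_num) Complex.I t
      convert this using 2
      · ext v
        rw [Complex.ofReal_exp, ← Complex.exp_add, real_inner_comm]
        congr 1
        push_cast
        ring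
      · rw [Complex.I_sq]
        congr 1
        ring
    -- At `t = 0` the Fourier integral is `Z` itself, so the explicit value of the constant is never
    -- needed.
    have h0 := h1 0
    have hZc : (Z : ℂ) = (Real.pi / (1 / 2 : ℂ)) ^ (Module.finrank ℝ (Vec m) / 2 : ℂ) := by
      rw [hZ, ← integral_complex_ofReal]
      simpa using h0
    intro t
    rw [h1, hZc]
  have hdens : ∀ v : Vec m, Real.exp (-Real.log Z - ‖v‖ ^ 2 / 2)
      = Z⁻¹ * Real.exp (-‖v‖ ^ 2 / 2) := by
    intro v
    rw [sub_eq_add_neg, Real.exp_add, Real.exp_neg, Real.exp_log hZpos, neg_div]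
  refine ⟨-Real.log Z, ?_⟩
  simp only [hdens]
  have hfin : IsFiniteMeasure ((volume : Measure (Vec m)).withDensity
      (fun v => ENNReal.ofReal (Z⁻¹ * Real.exp (-‖v‖ ^ 2 / 2)))) :=
    isFiniteMeasure_withDensity_ofReal (hint.const_mul _).2
  refine Measure.ext_of_charFun (funext fun t => ?_)
  rw [charFun_stdGaussian, charFun_apply, integral_withDensity_eq_integral_toReal_smul
    (by fun_prop) (ae_of_all _ fun _ => ENNReal.ofReal_lt_top)]
  have e : ∀ v : Vec m, (ENNReal.ofReal (Z⁻¹ * Real.exp (-‖v‖ ^ 2 / 2))).toReal •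
      Complex.exp (inner ℝ v t * Complex.I) =
      (Z : ℂ)⁻¹ * (Complex.exp (inner ℝ v t * Complex.I) * (Real.exp (-‖v‖ ^ 2 / 2) : ℂ)) := by
    intro v
    rw [ENNReal.toReal_ofReal (by positivity), Complex.real_smul]
    push_cast
    ring
  simp only [e]
  rw [integral_const_mul, hker, inv_mul_cancel_left₀ (by exact_mod_cast hZpos.ne')]

lemma det_toEuclideanLin_ne_zero {M : Matrix (Fin m) (Fin m) ℝ} (hM : IsUnit M.det) :
    LinearMap.det (Matrix.toEuclideanLin M) ≠ 0 := by
  have h : Matrix.toEuclideanLin M ∘ₗ Matrix.toEuclideanLin M⁻¹ = LinearMap.id := by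
    ext1 x
    apply WithLp.ofLp_injective
    simp [Matrix.toLpLin_apply, Matrix.mulVec_mulVec, Matrix.mul_nonsing_inv _ hM]
  have h2 := congrArg LinearMap.det h
  rw [LinearMap.det_comp, LinearMap.det_id] at h2
  exact left_ne_zero_of_mul_eq_one h2

/-- The Lebesgue density of a nondegenerate Gaussian; the normalisation does not depend on the
mean. -/
lemma multivariateGaussian_eq_withDensity {S : Matrix (Fin m) (Fin m) ℝ} (hS : S.PosDef) :
    ∃ c : ℝ, ∀ a : Vec m, multivariateGaussian a S = (volume : Measure (Vec m)).withDensity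
      (fun v => ENNReal.ofReal (Real.exp (c - quadForm S⁻¹ (v - a) / 2))) := by
  obtain ⟨c, hc⟩ := stdGaussian_eq_withDensity m
  have hd := isUnit_det_sqrt hS
  have hdet := det_toEuclideanLin_ne_zero hd
  set s := CFC.sqrt S with hs
  set J : ℝ := |(LinearMap.det (Matrix.toEuclideanLin s))⁻¹| with hJ
  have hJpos : 0 < J := abs_pos.2 (inv_ne_zero hdet)
  -- `Real.log J` accounts for the Jacobian of `v ↦ a + S^{1/2} v`, which does not depend on `a`.
  refine ⟨c + Real.log J, fun a => ?_⟩
  have hnorm : ∀ v : Vec m, ‖v‖ ^ 2 = quadForm S⁻¹ (Matrix.toEuclideanLin s v) := by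
    intro v
    rw [EuclideanSpace.real_norm_sq_eq, quadForm, Matrix.toLpLin_apply,
      ← sqrt_mul_sqrt hS, ← hs, Matrix.mul_inv_rev, Matrix.mulVec_mulVec, Matrix.mul_assoc,
      Matrix.nonsing_inv_mul _ hd, Matrix.mul_one, Matrix.dotProduct_mulVec,
      ← Matrix.mulVec_transpose, Matrix.transpose_nonsing_inv, hs, transpose_sqrt, ← hs,
      Matrix.mulVec_mulVec, Matrix.nonsing_inv_mul _ hd, Matrix.one_mulVec]
    simp [dotProduct, sq]
  have hmap : Measure.map (fun v => a + Matrix.toEuclideanLin s v) (volume : Measure (Vec m))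
      = ENNReal.ofReal J • volume := by
    have h1 := Measure.map_linearMap_addHaar_eq_smul_addHaar (volume : Measure (Vec m)) hdet
    have h2 : (fun v => a + Matrix.toEuclideanLin s v)
        = (fun w => a + w) ∘ (Matrix.toEuclideanLin s) := rfl
    rw [h2, ← Measure.map_map (measurable_const_add a)
      (LinearMap.continuous_of_finiteDimensional _).measurable, h1, Measure.map_smul,
      map_add_left_eq_self]
  have hmeas : Measurable (fun v : Vec m => a + Matrix.toEuclideanLin s v) :=
    ((LinearMap.continuous_of_finiteDimensional _).measurable).const_add a
  have hf : Measurable (fun v : Vec m =>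
      ENNReal.ofReal (Real.exp (c + Real.log J - quadForm S⁻¹ (v - a) / 2))) := by
    have : Continuous (fun v : Vec m => quadForm S⁻¹ (v - a)) := by fun_prop
    fun_prop
  ext B hB
  rw [multivariateGaussian, ← hs, hc, withDensity_apply _ hB]
  change Measure.map (fun v => a + Matrix.toEuclideanLin s v) _ B = _
  rw [Measure.map_apply hmeas hB, withDensity_apply _ (hmeas hB)]
  have e : ∀ v : Vec m, ENNReal.ofReal (Real.exp (c - ‖v‖ ^ 2 / 2)) = (ENNReal.ofReal J)⁻¹ *
      ENNReal.ofReal (Real.exp (c + Real.log J -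
        quadForm S⁻¹ ((a + Matrix.toEuclideanLin s v) - a) / 2)) := by
    intro v
    rw [add_sub_cancel_left, ← hnorm, ← ENNReal.ofReal_inv_of_pos hJpos,
      ← ENNReal.ofReal_mul (by positivity), add_sub_right_comm, Real.exp_add, Real.exp_log hJpos]
    congr 1
    field_simp
  simp only [e]
  have h1 := lintegral_const_mul (μ := volume.restrict
    ((fun v => a + Matrix.toEuclideanLin s v) ⁻¹' B)) (ENNReal.ofReal J)⁻¹ (hf.comp hmeas)
  have h2 := setLIntegral_map (μ := volume) hB hf hmeas
  simp only [Function.comp_def] at h1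
  rw [h1, ← h2, hmap,
    Measure.restrict_smul, lintegral_smul_measure, smul_eq_mul, ← mul_assoc,
    ENNReal.inv_mul_cancel (by simpa using hJpos) ENNReal.ofReal_ne_top, one_mul]

end GaussianDensity

/-! ### Relative entropy under a change of reference measure -/

section Divergence

open InformationTheory

lemma llr_withDensity_exp {α : Type*} [MeasurableSpace α] {μ ν : Measure α} [SigmaFinite μ]
    [SigmaFinite ν] (hμ : μ ≪ ν) {g : α → ℝ} (hg : Measurable g) :
    llr μ (ν.withDensity fun a => ENNReal.ofReal (Real.exp (g a)))
      =ᵐ[μ] fun a => llr μ ν a - g a := by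
  have h := Measure.rnDeriv_withDensity_right μ ν (f := fun a => ENNReal.ofReal (Real.exp (g a)))
    (by fun_prop) (ae_of_all _ fun a => by simp [Real.exp_pos])
    (ae_of_all _ fun a => ENNReal.ofReal_ne_top)
  filter_upwards [hμ.ae_le h, Measure.rnDeriv_pos hμ, hμ.ae_le (Measure.rnDeriv_ne_top μ ν)]
    with a ha hpos htop
  have hpos' : 0 < (μ.rnDeriv ν a).toReal := ENNReal.toReal_pos hpos.ne' htop
  rw [llr, ha, ENNReal.toReal_mul, ENNReal.toReal_inv, ENNReal.toReal_ofReal (Real.exp_pos _).le,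
    Real.log_mul (by positivity) hpos'.ne', Real.log_inv, Real.log_exp, llr]
  ring

/-- Change of the reference measure in the Kullback-Leibler divergence. -/
lemma klDiv_change_reference {α : Type*} [MeasurableSpace α] {μ ν : Measure α}
    [IsProbabilityMeasure μ] [SigmaFinite ν] (hμ : μ ≪ ν) {g₁ g₂ : α → ℝ} (hg₁ : Measurable g₁)
    (hg₂ : Measurable g₂) {ν₁ ν₂ : Measure α} [IsProbabilityMeasure ν₁] [IsProbabilityMeasure ν₂]
    (h₁ : ν₁ = ν.withDensity fun a => ENNReal.ofReal (Real.exp (g₁ a)))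
    (h₂ : ν₂ = ν.withDensity fun a => ENNReal.ofReal (Real.exp (g₂ a)))
    (hint : Integrable (fun a => g₁ a - g₂ a) μ) (hfin : klDiv μ ν₁ ≠ ∞) :
    klDiv μ ν₂ ≠ ∞ ∧ (klDiv μ ν₂).toReal = (klDiv μ ν₁).toReal + ∫ a, (g₁ a - g₂ a) ∂μ := by
  have hac : ∀ g : α → ℝ, Measurable g →
      μ ≪ ν.withDensity fun a => ENNReal.ofReal (Real.exp (g a)) := fun g hg =>
    hμ.trans (withDensity_absolutelyContinuous' (by fun_prop)
      (ae_of_all _ fun a => by simp [Real.exp_pos]))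
  have hac₁ : μ ≪ ν₁ := h₁ ▸ hac g₁ hg₁
  have hac₂ : μ ≪ ν₂ := h₂ ▸ hac g₂ hg₂
  have e : llr μ ν₂ =ᵐ[μ] fun a => llr μ ν₁ a + (g₁ a - g₂ a) := by
    filter_upwards [h₁ ▸ llr_withDensity_exp hμ hg₁, h₂ ▸ llr_withDensity_exp hμ hg₂] with a ha hb
    rw [ha, hb]; ring
  have hi₁ := (klDiv_ne_top_iff.1 hfin).2
  refine ⟨klDiv_ne_top hac₂ ((integrable_congr e).2 (hi₁.add hint)), ?_⟩
  rw [toReal_klDiv_of_measure_eq hac₂ (by simp), toReal_klDiv_of_measure_eq hac₁ (by simp),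
    integral_congr_ae e, integral_add hi₁ hint]

/-- Absolute continuity writes the divergence as an integral of `klFun` of the kernel derivative,
which is jointly measurable. -/
lemma measurable_klDiv_kernel {α β : Type*} [MeasurableSpace α] [MeasurableSpace β]
    [MeasurableSpace.CountablyGenerated β] (κ : Kernel α β) [IsFiniteKernel κ] (ν : Measure β)
    [IsFiniteMeasure ν] (h : ∀ a, κ a ≪ ν) : Measurable fun a => klDiv (κ a) ν := by
  have e : ∀ a, klDiv (κ a) ν =
      ∫⁻ b, ENNReal.ofReal (klFun (κ.rnDeriv (Kernel.const α ν) a b).toReal) ∂ν := by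
    intro a
    rw [klDiv_eq_lintegral_klFun_of_ac (h a)]
    have := Kernel.rnDeriv_eq_rnDeriv_measure (κ := κ) (η := Kernel.const α ν) (a := a)
    rw [Kernel.const_apply] at this
    refine lintegral_congr_ae ?_
    filter_upwards [this] with b hb
    rw [hb]
  simp only [e]
  refine Measurable.lintegral_prod_right' (f := fun p : α × β =>
    ENNReal.ofReal (klFun (κ.rnDeriv (Kernel.const α ν) p.1 p.2).toReal)) ?_
  exact (measurable_klFun.comp (Kernel.measurable_rnDeriv _ _).ennreal_toReal).ennreal_ofReal

end Divergence

/-! ### Linear Gaussian policies and their state laws -/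

section GaussianPolicy

variable {n m l : ℕ}

@[fun_prop]
lemma continuous_toEuclideanLin (M : Matrix (Fin m) (Fin n) ℝ) :
    Continuous (Matrix.toEuclideanLin M) :=
  LinearMap.continuous_of_finiteDimensional _

@[fun_prop]
lemma measurable_toEuclideanLin (M : Matrix (Fin m) (Fin n) ℝ) :
    Measurable (Matrix.toEuclideanLin M) :=
  (continuous_toEuclideanLin M).measurable

@[fun_prop]
lemma continuous_step (A : Matrix (Fin n) (Fin n) ℝ) (B : Matrix (Fin n) (Fin m) ℝ) :
    Continuous (step A B) := by
  unfold step
  fun_prop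

lemma memLp_toEuclideanLin {α : Type*} [MeasurableSpace α] {μ : Measure α}
    (M : Matrix (Fin m) (Fin n) ℝ) {f : α → Vec n} (hf : MemLp f 2 μ) :
    MemLp (fun a => Matrix.toEuclideanLin M (f a)) 2 μ :=
  (LinearMap.toContinuousLinearMap (Matrix.toEuclideanLin M)).comp_memLp' hf

/-- The Gaussian kernel `x ↦ N(K x, S)`. -/
def gaussKernel (K : Matrix (Fin m) (Fin n) ℝ) (S : Matrix (Fin m) (Fin m) ℝ) :
    Kernel (Vec n) (Vec m) :=
  (Kernel.id ×ₖ Kernel.const (Vec n) (multivariateGaussian 0 S)).map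
    (fun p => Matrix.toEuclideanLin K p.1 + p.2)

lemma gaussKernel_apply_eq_map (K : Matrix (Fin m) (Fin n) ℝ) (S : Matrix (Fin m) (Fin m) ℝ)
    (x : Vec n) : gaussKernel K S x =
      (multivariateGaussian 0 S).map (fun w => Matrix.toEuclideanLin K x + w) := by
  rw [gaussKernel, Kernel.map_apply _ (by fun_prop), Kernel.prod_apply, Kernel.id_apply,
    Kernel.const_apply, Measure.dirac_prod, Measure.map_map (by fun_prop) (by fun_prop)]
  rfl

lemma gaussKernel_apply (K : Matrix (Fin m) (Fin n) ℝ) (S : Matrix (Fin m) (Fin m) ℝ)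
    (x : Vec n) :
    gaussKernel K S x = multivariateGaussian (Matrix.toEuclideanLin K x) S := by
  rw [gaussKernel_apply_eq_map, multivariateGaussian, multivariateGaussian,
    Measure.map_map (by fun_prop) (by fun_prop)]
  congr 1
  ext1 w
  simp

instance (K : Matrix (Fin m) (Fin n) ℝ) (S : Matrix (Fin m) (Fin m) ℝ) :
    IsMarkovKernel (gaussKernel K S) :=
  ⟨fun x => by rw [gaussKernel_apply]; infer_instance⟩

/-- The input is a linear feedback plus noise independent of the state; laws and moments then reduce
to a product measure. -/
lemma compProd_gaussKernel (μ : Measure (Vec n)) [IsProbabilityMeasure μ]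
    (K : Matrix (Fin m) (Fin n) ℝ) (S : Matrix (Fin m) (Fin m) ℝ) :
    μ ⊗ₘ gaussKernel K S = (μ.prod (multivariateGaussian 0 S)).map
      (fun p => (p.1, Matrix.toEuclideanLin K p.1 + p.2)) := by
  ext s hs
  have hm : Measurable (fun p : Vec n × Vec m => (p.1, Matrix.toEuclideanLin K p.1 + p.2)) := by
    fun_prop
  rw [Measure.compProd_apply hs, Measure.map_apply hm hs, Measure.prod_apply (hm hs)]
  refine lintegral_congr fun x => ?_
  rw [gaussKernel_apply_eq_map, Measure.map_apply (by fun_prop) (measurable_prodMk_left hs)]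
  rfl

lemma inner_toEuclideanLin (M : Matrix (Fin m) (Fin n) ℝ) (x : Vec n) (t : Vec m) :
    inner ℝ (Matrix.toEuclideanLin M x) t = inner ℝ x (Matrix.toEuclideanLin Mᵀ t) := by
  rw [EuclideanSpace.inner_eq_star_dotProduct, EuclideanSpace.inner_eq_star_dotProduct]
  simp only [Matrix.toLpLin_apply, star_trivial]
  rw [Matrix.dotProduct_mulVec, ← Matrix.mulVec_transpose, dotProduct_comm,
    Matrix.dotProduct_mulVec, ← Matrix.mulVec_transpose, dotProduct_comm, dotProduct_comm]

lemma charFun_map_multivariateGaussian {S : Matrix (Fin n) (Fin n) ℝ} (hS : S.PosSemidef)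
    (M : Matrix (Fin m) (Fin n) ℝ) (t : Vec m) :
    charFun ((multivariateGaussian 0 S).map (Matrix.toEuclideanLin M)) t =
      Complex.exp (-(quadForm (M * S * Mᵀ) t / 2 : ℝ)) := by
  rw [charFun_apply, integral_map (by fun_prop) (by fun_prop)]
  simp only [inner_toEuclideanLin]
  rw [← charFun_apply, charFun_multivariateGaussian hS, inner_zero_right, quadForm,
    ← Matrix.mulVec_mulVec, ← Matrix.mulVec_mulVec, Matrix.dotProduct_mulVec t.ofLp M,
    ← Matrix.mulVec_transpose, Matrix.toLpLin_apply]
  congr 1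
  push_cast
  ring

lemma map_add_multivariateGaussian {S₁ : Matrix (Fin n) (Fin n) ℝ} (hS₁ : S₁.PosSemidef)
    {S₂ : Matrix (Fin m) (Fin m) ℝ} (hS₂ : S₂.PosSemidef) (M₁ : Matrix (Fin l) (Fin n) ℝ)
    (M₂ : Matrix (Fin l) (Fin m) ℝ) :
    ((multivariateGaussian 0 S₁).prod (multivariateGaussian 0 S₂)).map
        (fun p => Matrix.toEuclideanLin M₁ p.1 + Matrix.toEuclideanLin M₂ p.2) =
      multivariateGaussian 0 (M₁ * S₁ * M₁ᵀ + M₂ * S₂ * M₂ᵀ) := by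
  have e : ((multivariateGaussian 0 S₁).prod (multivariateGaussian 0 S₂)).map
        (fun p => Matrix.toEuclideanLin M₁ p.1 + Matrix.toEuclideanLin M₂ p.2) =
      ((multivariateGaussian 0 S₁).map (Matrix.toEuclideanLin M₁)) ∗
        ((multivariateGaussian 0 S₂).map (Matrix.toEuclideanLin M₂)) := by
    rw [Measure.conv, Measure.map_prod_map _ _ (by fun_prop) (by fun_prop),
      Measure.map_map (by fun_prop) (by fun_prop)]
    rfl
  rw [e]
  have := Measure.isProbabilityMeasure_map (μ := multivariateGaussian 0 S₁)
    (measurable_toEuclideanLin M₁).aemeasurable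
  have := Measure.isProbabilityMeasure_map (μ := multivariateGaussian 0 S₂)
    (measurable_toEuclideanLin M₂).aemeasurable
  refine Measure.ext_of_charFun (funext fun t => ?_)
  rw [charFun_conv, charFun_map_multivariateGaussian hS₁, charFun_map_multivariateGaussian hS₂,
    ← Complex.exp_add,
    charFun_multivariateGaussian ((posSemidef_conj hS₁ M₁).add (posSemidef_conj hS₂ M₂)),
    inner_zero_right, Matrix.add_mulVec, dotProduct_add]
  congr 1
  simp only [quadForm]
  push_cast
  ring

lemma toEuclideanLin_mul_apply (M : Matrix (Fin l) (Fin m) ℝ) (N : Matrix (Fin m) (Fin n) ℝ)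
    (x : Vec n) : Matrix.toEuclideanLin (M * N) x =
      Matrix.toEuclideanLin M (Matrix.toEuclideanLin N x) := by
  simp [Matrix.toLpLin_apply, Matrix.mulVec_mulVec]

/-- One step of the state law under a linear Gaussian policy. -/
lemma map_step_gaussKernel {X : Matrix (Fin n) (Fin n) ℝ} (hX : X.PosSemidef)
    {S : Matrix (Fin m) (Fin m) ℝ} (hS : S.PosSemidef) (A : Matrix (Fin n) (Fin n) ℝ)
    (B : Matrix (Fin n) (Fin m) ℝ) (K : Matrix (Fin m) (Fin n) ℝ) :
    ((multivariateGaussian 0 X) ⊗ₘ gaussKernel K S).map (step A B) =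
      multivariateGaussian 0 ((A + B * K) * X * (A + B * K)ᵀ + B * S * Bᵀ) := by
  rw [compProd_gaussKernel, Measure.map_map (by fun_prop) (by fun_prop),
    ← map_add_multivariateGaussian hX hS]
  congr 1
  ext1 p
  simp only [Function.comp_apply, step, map_add, LinearMap.add_apply, toEuclideanLin_mul_apply]
  abel

lemma memLp_snd_gaussKernel (X : Matrix (Fin n) (Fin n) ℝ) (K : Matrix (Fin m) (Fin n) ℝ)
    (S : Matrix (Fin m) (Fin m) ℝ) :
    MemLp Prod.snd 2 ((multivariateGaussian 0 X) ⊗ₘ gaussKernel K S) := by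
  rw [compProd_gaussKernel, memLp_map_measure_iff (by fun_prop) (by fun_prop)]
  have h1 : MemLp (fun p : Vec n × Vec m => p.1) 2
      ((multivariateGaussian 0 X).prod (multivariateGaussian 0 S)) :=
    IsGaussian.memLp_two_id.comp_fst _
  have h2 : MemLp (fun p : Vec n × Vec m => p.2) 2
      ((multivariateGaussian 0 X).prod (multivariateGaussian 0 S)) :=
    IsGaussian.memLp_two_id.comp_snd _
  exact (memLp_toEuclideanLin K h1).add h2

end GaussianPolicy

/-! ### The entropy identity for one stage -/

section OneStep

open InformationTheory

variable {n m : ℕ}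

lemma integrable_integral_compProd {μ : Measure (Vec n)} [SFinite μ]
    {κ : Kernel (Vec n) (Vec m)} [IsSFiniteKernel κ] {f : Vec n × Vec m → ℝ}
    (hf : Integrable f (μ ⊗ₘ κ)) : Integrable (fun x => ∫ u, f (x, u) ∂(κ x)) μ := by
  rw [Measure.compProd] at hf
  simpa using hf.integral_compProd

lemma memLp_fst_compProd {μ : Measure (Vec n)} [IsProbabilityMeasure μ] (hμ : MemLp id 2 μ)
    (κ : Kernel (Vec n) (Vec m)) [IsMarkovKernel κ] : MemLp Prod.fst 2 (μ ⊗ₘ κ) := by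
  rw [← Measure.fst_compProd μ κ, Measure.fst, memLp_map_measure_iff (by fun_prop) (by fun_prop)]
    at hμ
  exact hμ

lemma memLp_map_step {J : Measure (Vec n × Vec m)} (h1 : MemLp Prod.fst 2 J)
    (h2 : MemLp Prod.snd 2 J) (A : Matrix (Fin n) (Fin n) ℝ) (B : Matrix (Fin n) (Fin m) ℝ) :
    MemLp id 2 (J.map (step A B)) := by
  rw [memLp_map_measure_iff (by fun_prop) (by fun_prop)]
  exact (memLp_toEuclideanLin A h1).add (memLp_toEuclideanLin B h2)

/-- The drift of the potential `x ↦ ½ xᵀ P x` along a step, plus the running cost of the input. -/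
def drift (P' P A : Matrix (Fin n) (Fin n) ℝ) (B : Matrix (Fin n) (Fin m) ℝ) (c : ℝ)
    (p : Vec n × Vec m) : ℝ :=
  c + ‖p.2‖ ^ 2 / 2 + (quadForm P' (step A B p) / 2 - quadForm P p.1 / 2)

variable {P' P A : Matrix (Fin n) (Fin n) ℝ} {B : Matrix (Fin n) (Fin m) ℝ} {c : ℝ}

lemma integrable_drift {J : Measure (Vec n × Vec m)} [IsFiniteMeasure J]
    (h1 : MemLp Prod.fst 2 J) (h2 : MemLp Prod.snd 2 J) : Integrable (drift P' P A B c) J := by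
  have h3 : MemLp (step A B) 2 J := (memLp_toEuclideanLin A h1).add (memLp_toEuclideanLin B h2)
  have h4 := (memLp_two_iff_integrable_sq_norm h2.1).1 h2
  exact ((integrable_const c).add (h4.div_const 2)).add
    (((integrable_quadForm P' h3).div_const 2).sub ((integrable_quadForm P h1).div_const 2))

lemma integral_drift {μ : Measure (Vec n)} [IsProbabilityMeasure μ]
    {κ : Kernel (Vec n) (Vec m)} [IsMarkovKernel κ] (h1 : MemLp Prod.fst 2 (μ ⊗ₘ κ))
    (h2 : MemLp Prod.snd 2 (μ ⊗ₘ κ)) :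
    ∫ p, drift P' P A B c p ∂(μ ⊗ₘ κ) = c + ∫ p, ‖p.2‖ ^ 2 / 2 ∂(μ ⊗ₘ κ) +
      ((∫ x, quadForm P' x ∂((μ ⊗ₘ κ).map (step A B))) / 2 - (∫ x, quadForm P x ∂μ) / 2) := by
  have h3 : MemLp (step A B) 2 (μ ⊗ₘ κ) :=
    (memLp_toEuclideanLin A h1).add (memLp_toEuclideanLin B h2)
  have h4 := ((memLp_two_iff_integrable_sq_norm h2.1).1 h2).div_const 2
  have h5 := (integrable_quadForm P' h3).div_const 2
  have h6 := (integrable_quadForm P h1).div_const 2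
  have e : ∫ x, quadForm P x ∂μ = ∫ p, quadForm P p.1 ∂(μ ⊗ₘ κ) := by
    conv_lhs => rw [← Measure.fst_compProd μ κ, Measure.fst]
    rw [integral_map (by fun_prop) (by fun_prop)]
  rw [integral_map (by fun_prop) (by fun_prop), e, ← integral_div, ← integral_div]
  simp only [drift]
  have hc : Integrable (fun _ : Vec n × Vec m => c) (μ ⊗ₘ κ) := integrable_const c
  have h7 := integral_add (hc.add h4) (h5.sub h6)
  simp only [Pi.add_apply, Pi.sub_apply] at h7
  rw [h7, integral_sub h5 h6, integral_add hc h4]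
  simp

lemma absolutelyContinuous_withDensity_exp {ρ : Measure (Vec m)} {g : Vec m → ℝ}
    (hg : Measurable g)
    (hρ : ρ = (volume : Measure (Vec m)).withDensity fun u => ENNReal.ofReal (Real.exp (g u))) :
    (volume : Measure (Vec m)) ≪ ρ := by
  rw [hρ]
  exact withDensity_absolutelyContinuous' (by fun_prop) (ae_of_all _ fun a => by simp [Real.exp_pos])

variable {μ : Measure (Vec n)} [IsProbabilityMeasure μ] {κ κ₀ : Kernel (Vec n) (Vec m)}
  [IsMarkovKernel κ] [IsMarkovKernel κ₀] {ρ : Measure (Vec m)} [IsProbabilityMeasure ρ]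
  {g : Vec m → ℝ} {g₀ : Vec n → Vec m → ℝ}

/-- The expected stage cost of the policy `κ` when the state has law `μ`. -/
def stageCost (μ : Measure (Vec n)) (κ : Kernel (Vec n) (Vec m)) (ρ : Measure (Vec m)) : ℝ≥0∞ :=
  ∫⁻ p, (ENNReal.ofReal (‖p.2‖ ^ 2 / 2) + klDiv (κ p.1) ρ) ∂(μ ⊗ₘ κ)

lemma stageCost_eq (hκρ : ∀ x, κ x ≪ ρ) : stageCost μ κ ρ =
    ∫⁻ p, ENNReal.ofReal (‖p.2‖ ^ 2 / 2) ∂(μ ⊗ₘ κ) + ∫⁻ x, klDiv (κ x) ρ ∂μ := by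
  rw [stageCost, lintegral_add_left (by fun_prop)]
  congr 1
  have h := Measure.lintegral_compProd (μ := μ) (κ := κ) (f := fun p => klDiv (κ p.1) ρ)
    ((measurable_klDiv_kernel κ ρ hκρ).comp measurable_fst)
  rw [h]
  simp

/-- For an arbitrary policy, finiteness of the cost is the only source of second moments of the
input. -/
lemma lintegral_sq_norm_ne_top_iff {J : Measure (Vec n × Vec m)} :
    ∫⁻ p, ENNReal.ofReal (‖p.2‖ ^ 2 / 2) ∂J ≠ ∞ ↔ MemLp Prod.snd 2 J := by
  rw [memLp_two_iff_integrable_sq_norm (by fun_prop),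
    lintegral_ofReal_ne_top_iff_integrable (by fun_prop) (ae_of_all _ fun p => by positivity)]
  constructor
  · intro h
    refine (h.mul_const 2).congr (ae_of_all _ fun p => ?_)
    simp
  · exact fun h => h.div_const 2

/-- The gap between a policy of finite stage cost and the linear Gaussian policy, expressed
by a relative entropy. -/
lemma stage_identity (hμ : MemLp id 2 μ) (hκ : ∀ x, κ x ≪ (volume : Measure (Vec m)))
    (hg : Measurable g)
    (hρ : ρ = (volume : Measure (Vec m)).withDensity fun u => ENNReal.ofReal (Real.exp (g u)))
    (hg₀ : ∀ x, Measurable (g₀ x))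
    (hκ₀ : ∀ x, κ₀ x =
      (volume : Measure (Vec m)).withDensity fun u => ENNReal.ofReal (Real.exp (g₀ x u)))
    (hd : ∀ x u, g u - g₀ x u = drift P' P A B c (x, u)) (hfin : stageCost μ κ ρ ≠ ∞) :
    MemLp id 2 ((μ ⊗ₘ κ).map (step A B)) ∧ (∀ᵐ x ∂μ, klDiv (κ x) (κ₀ x) ≠ ∞) ∧
      Integrable (fun x => (klDiv (κ x) (κ₀ x)).toReal) μ ∧
      ∫ x, (klDiv (κ x) (κ₀ x)).toReal ∂μ = (stageCost μ κ ρ).toReal + c +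
        ((∫ x, quadForm P' x ∂((μ ⊗ₘ κ).map (step A B))) / 2 - (∫ x, quadForm P x ∂μ) / 2) := by
  have hκρ : ∀ x, κ x ≪ ρ := fun x => (hκ x).trans (absolutelyContinuous_withDensity_exp hg hρ)
  have hKm := measurable_klDiv_kernel κ ρ hκρ
  rw [stageCost_eq hκρ] at hfin ⊢
  obtain ⟨hf1, hf2⟩ := ENNReal.add_ne_top.1 hfin
  have h1 := memLp_fst_compProd hμ κ
  have h2 := lintegral_sq_norm_ne_top_iff.1 hf1
  have hi := integrable_drift (P' := P') (P := P) (A := A) (B := B) (c := c) h1 h2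
  have hK : ∀ᵐ x ∂μ, klDiv (κ x) ρ < ∞ := ae_lt_top hKm hf2
  have hKi := integrable_toReal_of_lintegral_ne_top hKm.aemeasurable hf2
  -- Integrability for the joint law passes to the conditional laws only for almost every state,
  -- hence the almost-everywhere form of `key`.
  have hslice := ((Measure.integrable_compProd_iff hi.1).1 hi).1
  have key : ∀ᵐ x ∂μ, klDiv (κ x) (κ₀ x) ≠ ∞ ∧ (klDiv (κ x) (κ₀ x)).toReal =
      (klDiv (κ x) ρ).toReal + ∫ u, drift P' P A B c (x, u) ∂(κ x) := by
    filter_upwards [hK, hslice] with x hx hsx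
    simp only [← hd] at hsx ⊢
    exact klDiv_change_reference (hκ x) hg (hg₀ x) hρ (hκ₀ x) hsx hx.ne
  have hkey : (fun x => (klDiv (κ x) (κ₀ x)).toReal) =ᵐ[μ]
      fun x => (klDiv (κ x) ρ).toReal + ∫ u, drift P' P A B c (x, u) ∂(κ x) := by
    filter_upwards [key] with x hx using hx.2
  have hi' := integrable_integral_compProd hi
  refine ⟨memLp_map_step h1 h2 A B, key.mono fun x hx => hx.1,
    (integrable_congr hkey).2 (hKi.add hi'), ?_⟩
  have hsq : ∫ p, ‖p.2‖ ^ 2 / 2 ∂(μ ⊗ₘ κ) =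
      (∫⁻ p, ENNReal.ofReal (‖p.2‖ ^ 2 / 2) ∂(μ ⊗ₘ κ)).toReal :=
    integral_eq_lintegral_of_nonneg_ae (ae_of_all _ fun p => by positivity) (by fun_prop)
  rw [integral_congr_ae hkey, integral_add hKi hi', integral_toReal hKm.aemeasurable hK,
    ← Measure.integral_compProd hi, integral_drift h1 h2, hsq, ENNReal.toReal_add hf1 hf2]
  ring

/-- The divergence of `κ₀ x` from itself is zero; changing the reference to `ρ` leaves minus the
integral of the drift, which second moments make integrable. -/
lemma stageCost_ne_top (hμ : MemLp id 2 μ) (hg : Measurable g)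
    (hρ : ρ = (volume : Measure (Vec m)).withDensity fun u => ENNReal.ofReal (Real.exp (g u)))
    (hg₀ : ∀ x, Measurable (g₀ x))
    (hκ₀ : ∀ x, κ₀ x =
      (volume : Measure (Vec m)).withDensity fun u => ENNReal.ofReal (Real.exp (g₀ x u)))
    (hd : ∀ x u, g u - g₀ x u = drift P' P A B c (x, u)) (h2 : MemLp Prod.snd 2 (μ ⊗ₘ κ₀)) :
    stageCost μ κ₀ ρ ≠ ∞ := by
  have hvol : ∀ x, κ₀ x ≪ (volume : Measure (Vec m)) := fun x => by
    rw [hκ₀ x]; exact withDensity_absolutelyContinuous _ _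
  rw [stageCost_eq fun x => (hvol x).trans (absolutelyContinuous_withDensity_exp hg hρ)]
  refine ENNReal.add_ne_top.2 ⟨lintegral_sq_norm_ne_top_iff.2 h2, ?_⟩
  have h1 := memLp_fst_compProd hμ κ₀
  have hi := integrable_drift (P' := P') (P := P) (A := A) (B := B) (c := c) h1 h2
  have hslice := ((Measure.integrable_compProd_iff hi.1).1 hi).1
  have key : ∀ᵐ x ∂μ, klDiv (κ₀ x) ρ =
      ENNReal.ofReal (-∫ u, drift P' P A B c (x, u) ∂(κ₀ x)) := by
    filter_upwards [hslice] with x hsx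
    have hneg : ∀ u, g₀ x u - g u = -drift P' P A B c (x, u) := fun u => by rw [← hd]; ring
    have h := klDiv_change_reference (hvol x) (hg₀ x) hg (hκ₀ x) hρ
      (by simp only [hneg]; exact hsx.neg) (by simp)
    rw [← ENNReal.ofReal_toReal h.1, h.2]
    simp only [klDiv_self, ENNReal.toReal_zero, zero_add, hneg, integral_neg]
  rw [lintegral_congr_ae key]
  exact (integrable_integral_compProd hi).neg.lintegral_lt_top.ne

end OneStep

/-! ### Verification, optimality and uniqueness -/

section Optimality

open InformationTheory

variable {n m : ℕ}

/-- The log-density of the prior `ρ` relative to `κ₀ x` is the running cost of the input plus the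
increment of the potential `½ xᵀ P x`, up to the constant `c`. -/
def HasPotential (A : Matrix (Fin n) (Fin n) ℝ) (B : Matrix (Fin n) (Fin m) ℝ)
    (ρ : Measure (Vec m)) (κ₀ : Kernel (Vec n) (Vec m)) (P' P : Matrix (Fin n) (Fin n) ℝ)
    (c : ℝ) : Prop :=
  ∃ (g : Vec m → ℝ) (g₀ : Vec n → Vec m → ℝ), Measurable g ∧
    (ρ = (volume : Measure (Vec m)).withDensity fun u => ENNReal.ofReal (Real.exp (g u))) ∧
    (∀ x, Measurable (g₀ x)) ∧
    (∀ x, κ₀ x =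
      (volume : Measure (Vec m)).withDensity fun u => ENNReal.ofReal (Real.exp (g₀ x u))) ∧
    ∀ x u, g u - g₀ x u = drift P' P A B c (x, u)

/-- The exponents differ by the completed square of `quadratic_step`; the identity term in the
precision supplies `½‖u‖²`. A single `c` serves all `x` because the Gaussian normalisation does not
depend on the mean. -/
lemma hasPotential_gaussKernel {P Q A : Matrix (Fin n) (Fin n) ℝ} {S : Matrix (Fin m) (Fin m) ℝ}
    {B : Matrix (Fin n) (Fin m) ℝ} (hP : IsUnit P) (hPs : Pᵀ = P) (hQ : IsUnit Q)
    (hA : IsUnit A) (hS : S.PosDef) (hL : (S⁻¹ + 1 + Bᵀ * P⁻¹ * B).PosDef)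
    (hPM : A * Q * Aᵀ = P + B * (S⁻¹ + 1)⁻¹ * Bᵀ) :
    ∃ c, HasPotential A B (multivariateGaussian 0 S)
      (gaussKernel (-((S⁻¹ + 1 + Bᵀ * P⁻¹ * B)⁻¹ * Bᵀ * P⁻¹ * A)) (S⁻¹ + 1 + Bᵀ * P⁻¹ * B)⁻¹)
      P⁻¹ Q⁻¹ c := by
  obtain ⟨c₁, h₁⟩ := multivariateGaussian_eq_withDensity hS
  obtain ⟨c₂, h₂⟩ := multivariateGaussian_eq_withDensity hL.inv
  have hR : (S⁻¹ + 1).PosDef := hS.inv.add_posSemidef Matrix.PosSemidef.one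
  have hq := quadratic_step hP hPs hQ hA hR.isUnit (transpose_eq_of_isHermitian hR.1) hL.isUnit hPM
  have hLi := Matrix.nonsing_inv_nonsing_inv _ ((Matrix.isUnit_iff_isUnit_det _).1 hL.isUnit)
  rw [hLi] at h₂
  set L := S⁻¹ + 1 + Bᵀ * P⁻¹ * B
  set K := -(L⁻¹ * Bᵀ * P⁻¹ * A)
  refine ⟨c₁ - c₂, fun u => c₁ - quadForm S⁻¹ (u - 0) / 2,
    fun x u => c₂ - quadForm L (u - Matrix.toEuclideanLin K x) / 2, ?_, h₁ 0, fun x => ?_,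
    fun x => ?_, fun x u => ?_⟩
  · have : Continuous fun u : Vec m => quadForm S⁻¹ (u - 0) := by fun_prop
    fun_prop
  · have : Continuous fun u : Vec m => quadForm L (u - Matrix.toEuclideanLin K x) := by fun_prop
    fun_prop
  · rw [gaussKernel_apply, h₂]
  · have h := hq x.ofLp u.ofLp
    have hn : ‖u‖ ^ 2 = u.ofLp ⬝ᵥ u.ofLp := by
      rw [EuclideanSpace.real_norm_sq_eq]
      simp [dotProduct, sq]
    simp only [drift, step, quadForm, hn, sub_zero, WithLp.ofLp_sub, WithLp.ofLp_add,
      Matrix.toLpLin_apply]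
    rw [Matrix.add_mulVec, Matrix.one_mulVec, dotProduct_add] at h
    linarith

variable {T : ℕ} {A : ℕ → Matrix (Fin n) (Fin n) ℝ} {B : ℕ → Matrix (Fin n) (Fin m) ℝ}
  {Sini Sfin : Matrix (Fin n) (Fin n) ℝ} {ρ : ℕ → Measure (Vec m)} {κ₀ : PolicyFamily n m}
  {P : ℕ → Matrix (Fin n) (Fin n) ℝ} {c : ℕ → ℝ}

lemma isProbabilityMeasure_stateLaw {π : PolicyFamily n m} (hπ : IsPolicy T π) {k : ℕ}
    (hk : k ≤ T) : IsProbabilityMeasure (stateLaw A B Sini π k) := by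
  induction k with
  | zero => rw [stateLaw]; infer_instance
  | succ k ih =>
    have := ih (Nat.le_of_lt hk)
    have := (hπ k hk).1
    rw [stateLaw]
    exact Measure.isProbabilityMeasure_map (by fun_prop)

lemma cost_eq_sum (π : PolicyFamily n m) : cost T A B Sini ρ π =
    ∑ k ∈ Finset.range T, stageCost (stateLaw A B Sini π k) (π k) (ρ k) := rfl

lemma stateLaw_stage (hρ : ∀ k < T, IsProbabilityMeasure (ρ k))
    (hκ₀ : ∀ k < T, IsMarkovKernel (κ₀ k))
    (hpot : ∀ k < T, HasPotential (A k) (B k) (ρ k) (κ₀ k) (P (k + 1)) (P k) (c k))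
    {π : PolicyFamily n m} (hπ : IsPolicy T π) (hfin : cost T A B Sini ρ π ≠ ∞)
    {k : ℕ} (hk : k < T) (hmom : MemLp id 2 (stateLaw A B Sini π k)) :
    MemLp id 2 (stateLaw A B Sini π (k + 1)) ∧
      (∀ᵐ x ∂(stateLaw A B Sini π k), klDiv (π k x) (κ₀ k x) ≠ ∞) ∧
      Integrable (fun x => (klDiv (π k x) (κ₀ k x)).toReal) (stateLaw A B Sini π k) ∧
      ∫ x, (klDiv (π k x) (κ₀ k x)).toReal ∂(stateLaw A B Sini π k) =
        (stageCost (stateLaw A B Sini π k) (π k) (ρ k)).toReal + c k +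
        ((∫ x, quadForm (P (k + 1)) x ∂(stateLaw A B Sini π (k + 1))) / 2 -
          (∫ x, quadForm (P k) x ∂(stateLaw A B Sini π k)) / 2) := by
  obtain ⟨g, g₀, hg, hρg, hg₀, hκg, hd⟩ := hpot k hk
  have := hρ k hk
  have := hκ₀ k hk
  have := (hπ k hk).1
  have := isProbabilityMeasure_stateLaw (A := A) (B := B) (Sini := Sini) hπ hk.le
  rw [cost_eq_sum, ENNReal.sum_ne_top] at hfin
  exact stage_identity hmom (hπ k hk).2 hg hρg hg₀ hκg hd (hfin k (Finset.mem_range.2 hk))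

/-- Moments propagate forward: finite cost bounds the input at each stage, and the next state is
linear in state and input. -/
lemma memLp_stateLaw (hρ : ∀ k < T, IsProbabilityMeasure (ρ k))
    (hκ₀ : ∀ k < T, IsMarkovKernel (κ₀ k))
    (hpot : ∀ k < T, HasPotential (A k) (B k) (ρ k) (κ₀ k) (P (k + 1)) (P k) (c k))
    {π : PolicyFamily n m} (hπ : IsPolicy T π) (hfin : cost T A B Sini ρ π ≠ ∞)
    {k : ℕ} (hk : k ≤ T) : MemLp id 2 (stateLaw A B Sini π k) := by
  induction k with
  | zero =>
    rw [stateLaw]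
    exact IsGaussian.memLp_two_id
  | succ k ih => exact (stateLaw_stage hρ hκ₀ hpot hπ hfin hk (ih (Nat.le_of_lt hk))).1

/-- The cost of a policy is the total relative entropy to the reference policy, up to terms that
only depend on the initial and final laws. -/
lemma sum_klDiv_eq (hρ : ∀ k < T, IsProbabilityMeasure (ρ k))
    (hκ₀ : ∀ k < T, IsMarkovKernel (κ₀ k))
    (hpot : ∀ k < T, HasPotential (A k) (B k) (ρ k) (κ₀ k) (P (k + 1)) (P k) (c k))
    {π : PolicyFamily n m} (hπ : IsPolicy T π) (hfin : cost T A B Sini ρ π ≠ ∞) :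
    ∑ k ∈ Finset.range T, ∫ x, (klDiv (π k x) (κ₀ k x)).toReal ∂(stateLaw A B Sini π k) =
      (cost T A B Sini ρ π).toReal + ∑ k ∈ Finset.range T, c k +
        ((∫ x, quadForm (P T) x ∂(stateLaw A B Sini π T)) / 2 -
          (∫ x, quadForm (P 0) x ∂(multivariateGaussian 0 Sini)) / 2) := by
  have hfin' := hfin
  rw [cost_eq_sum, ENNReal.sum_ne_top] at hfin'
  rw [cost_eq_sum, ENNReal.toReal_sum hfin', ← Finset.sum_add_distrib]
  have htel := Finset.sum_range_sub
    (fun k => (∫ x, quadForm (P k) x ∂(stateLaw A B Sini π k)) / 2) T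
  change _ = _ - (∫ x, quadForm (P 0) x ∂(multivariateGaussian 0 Sini)) / 2 at htel
  rw [← htel, ← Finset.sum_add_distrib]
  refine Finset.sum_congr rfl fun k hk => ?_
  have hk' := Finset.mem_range.1 hk
  exact (stateLaw_stage hρ hκ₀ hpot hπ hfin hk'
    (memLp_stateLaw hρ hκ₀ hpot hπ hfin hk'.le)).2.2.2

/-- A feasible reference policy of finite cost is optimal, and any optimal policy agrees with it
along its own state law. -/
lemma isOptimal_of_hasPotential (hρ : ∀ k < T, IsProbabilityMeasure (ρ k))
    (hpot : ∀ k < T, HasPotential (A k) (B k) (ρ k) (κ₀ k) (P (k + 1)) (P k) (c k))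
    (hfeas : IsFeasible T A B Sini Sfin κ₀) (hfin : cost T A B Sini ρ κ₀ ≠ ∞) :
    IsOptimal T A B Sini Sfin ρ κ₀ ∧ ∀ π, IsOptimal T A B Sini Sfin ρ π → ∀ k < T,
      ∀ᵐ x ∂(stateLaw A B Sini π k), π k x = κ₀ k x := by
  have hκ₀ : ∀ k < T, IsMarkovKernel (κ₀ k) := fun k hk => (hfeas.1 k hk).1
  have hzero : ∑ k ∈ Finset.range T,
      ∫ x, (klDiv (κ₀ k x) (κ₀ k x)).toReal ∂(stateLaw A B Sini κ₀ k) = 0 := by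
    refine Finset.sum_eq_zero fun k hk => ?_
    have := hκ₀ k (Finset.mem_range.1 hk)
    simp
  have h₀ := sum_klDiv_eq hρ hκ₀ hpot hfeas.1 hfin
  rw [hzero, hfeas.2] at h₀
  have hgap : ∀ π, IsFeasible T A B Sini Sfin π → cost T A B Sini ρ π ≠ ∞ →
      (cost T A B Sini ρ π).toReal = (cost T A B Sini ρ κ₀).toReal + ∑ k ∈ Finset.range T,
        ∫ x, (klDiv (π k x) (κ₀ k x)).toReal ∂(stateLaw A B Sini π k) := by
    intro π hπ hπfin
    have h := sum_klDiv_eq hρ hκ₀ hpot hπ.1 hπfin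
    rw [hπ.2] at h
    linarith
  have hnn : ∀ (π : PolicyFamily n m), ∀ k ∈ Finset.range T,
      0 ≤ ∫ x, (klDiv (π k x) (κ₀ k x)).toReal ∂(stateLaw A B Sini π k) := fun π k _ =>
    integral_nonneg fun x => ENNReal.toReal_nonneg
  have hopt : IsOptimal T A B Sini Sfin ρ κ₀ := by
    refine ⟨hfeas, fun π hπ => ?_⟩
    by_cases hπfin : cost T A B Sini ρ π = ∞
    · rw [hπfin]; exact le_top
    · rw [← ENNReal.toReal_le_toReal hfin hπfin, hgap π hπ hπfin]
      linarith [Finset.sum_nonneg (hnn π)]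
  refine ⟨hopt, fun π hπ k hk => ?_⟩
  have hle := hπ.2 κ₀ hfeas
  have hπfin : cost T A B Sini ρ π ≠ ∞ := (hle.trans_lt hfin.lt_top).ne
  have hsum := hgap π hπ.1 hπfin
  rw [le_antisymm hle (hopt.2 π hπ.1)] at hsum
  have hz := (Finset.sum_eq_zero_iff_of_nonneg (hnn π)).1 (by linarith) k (Finset.mem_range.2 hk)
  obtain ⟨-, hf, hi, -⟩ := stateLaw_stage hρ hκ₀ hpot hπ.1.1 hπfin hk
    (memLp_stateLaw hρ hκ₀ hpot hπ.1.1 hπfin hk.le)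
  rw [integral_eq_zero_iff_of_nonneg (fun x => ENNReal.toReal_nonneg) hi] at hz
  have := hκ₀ k hk
  have := (hπ.1.1 k hk).1
  -- `ENNReal.toReal` sends `∞` to `0`, so a vanishing real value means zero divergence only
  -- together with the finiteness `hf`.
  filter_upwards [hf, hz] with x hx hzx
  exact klDiv_eq_zero_iff.1 (((ENNReal.toReal_eq_zero_iff _).1 hzx).resolve_right hx)

/-- Uniqueness first holds almost surely for the competitor's own state law; this identifies that
law with the known Gaussian one. -/
lemma stateLaw_congr {π π' : PolicyFamily n m} (hπ : IsPolicy T π) (hπ' : IsPolicy T π')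
    (h : ∀ k < T, ∀ᵐ x ∂(stateLaw A B Sini π k), π k x = π' k x) {k : ℕ} (hk : k ≤ T) :
    stateLaw A B Sini π k = stateLaw A B Sini π' k := by
  induction k with
  | zero => rfl
  | succ k ih =>
    have := (hπ k hk).1
    have := (hπ' k hk).1
    have := isProbabilityMeasure_stateLaw (A := A) (B := B) (Sini := Sini) hπ (Nat.le_of_lt hk)
    rw [stateLaw, stateLaw, ← ih (Nat.le_of_lt hk)]
    congr 1
    exact Measure.compProd_congr (h k hk)

lemma volume_absolutelyContinuous_multivariateGaussian {S : Matrix (Fin n) (Fin n) ℝ}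
    (hS : S.PosDef) (a : Vec n) :
    (volume : Measure (Vec n)) ≪ multivariateGaussian a S := by
  obtain ⟨c, hc⟩ := multivariateGaussian_eq_withDensity hS
  refine absolutelyContinuous_withDensity_exp (g := fun v => c - quadForm S⁻¹ (v - a) / 2) ?_ (hc a)
  have : Continuous fun v : Vec n => quadForm S⁻¹ (v - a) := by fun_prop
  fun_prop

lemma multivariateGaussian_absolutelyContinuous_volume {S : Matrix (Fin n) (Fin n) ℝ}
    (hS : S.PosDef) (a : Vec n) :
    multivariateGaussian a S ≪ (volume : Measure (Vec n)) := by
  obtain ⟨c, hc⟩ := multivariateGaussian_eq_withDensity hS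
  rw [hc a]
  exact withDensity_absolutelyContinuous _ _

end Optimality

end MIDensityControl

end

/-! ### The theorem for the given data -/

theorem theorem1 (n m T : ℕ) (hT : 1 ≤ T)
    (A : ℕ → Matrix (Fin n) (Fin n) ℝ) (B : ℕ → Matrix (Fin n) (Fin m) ℝ)
    (Sini Sfin : Matrix (Fin n) (Fin n) ℝ) (hSini : Sini.PosDef) (hSfin : Sfin.PosDef)
    (Sρ : ℕ → Matrix (Fin m) (Fin m) ℝ) (hSρ : ∀ k < T, (Sρ k).PosDef)
    (Bbar : ℕ → Matrix (Fin n) (Fin m) ℝ)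
    (hBbar : ∀ k < T, Bbar k = MIDensityControl.scaledInput B Sρ k)
    (hA : ∀ k < T, IsUnit (A k))
    (hG : ∃ kr : ℕ, 1 ≤ kr ∧ kr ≤ T ∧
      (∀ k, kr ≤ k → k ≤ T → IsUnit (MIDensityControl.reachGramian A Bbar k 0)) ∧
      (∀ k, k < kr → IsUnit (MIDensityControl.reachGramian A Bbar T k)))
    (hFminus : IsUnit (MIDensityControl.Fminus
      (MIDensityControl.S0 T A Bbar Sini) (MIDensityControl.ST T A Bbar Sfin)))
    (hFplus : IsUnit (MIDensityControl.Fplus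
      (MIDensityControl.S0 T A Bbar Sini) (MIDensityControl.ST T A Bbar Sfin)))
    (Q : ℕ → Matrix (Fin n) (Fin n) ℝ)
    (hQ0 : Q 0 = MIDensityControl.Qinit T A Bbar Sini Sfin)
    (hQ : ∀ k < T, Q (k + 1) = A k * Q k * (A k)ᵀ - Bbar k * (Bbar k)ᵀ) :
    (∀ k ≤ T, IsUnit (Q k)) ∧
    (∀ k < T, (MIDensityControl.optPrecision B Sρ Q k).PosDef) ∧
    ∃ π : MIDensityControl.PolicyFamily n m,
      (∀ k < T, ∀ x : MIDensityControl.Vec n,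
        π k x = multivariateGaussian
          (Matrix.toEuclideanLin (-((MIDensityControl.optPrecision B Sρ Q k)⁻¹ *
            (B k)ᵀ * (Q (k + 1))⁻¹ * A k)) x)
          (MIDensityControl.optPrecision B Sρ Q k)⁻¹) ∧
      MIDensityControl.IsOptimal T A B Sini Sfin (MIDensityControl.gaussianPrior Sρ) π ∧
      MIDensityControl.cost T A B Sini (MIDensityControl.gaussianPrior Sρ) π ≠ ∞ ∧
      ∀ π' : MIDensityControl.PolicyFamily n m,
        MIDensityControl.IsOptimal T A B Sini Sfin (MIDensityControl.gaussianPrior Sρ) π' →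
        ∀ k < T, ∀ᵐ x ∂(volume : Measure (MIDensityControl.Vec n)), π' k x = π k x := by
  open MIDensityControl in
  obtain ⟨kr, -, hkr, hG, -⟩ := hG
  obtain ⟨hU, hS, hP, hM, X, hX0, hXT, hXp, hXstep⟩ :=
    riccati_spec hSini hSfin hSρ hBbar hA (hG T hkr le_rfl) hFminus hQ0 hQ
  refine ⟨hU, hP, ?_⟩
  let π : PolicyFamily n m := fun k => gaussKernel
    (-((optPrecision B Sρ Q k)⁻¹ * (B k)ᵀ * (Q (k + 1))⁻¹ * A k)) (optPrecision B Sρ Q k)⁻¹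
  have hρ : ∀ k < T, IsProbabilityMeasure (gaussianPrior Sρ k) := fun k _ => by
    rw [gaussianPrior]; infer_instance
  have hpol : IsPolicy T π := fun k hk => ⟨inferInstance, fun x => by
    simp only [π, gaussKernel_apply]
    exact multivariateGaussian_absolutelyContinuous_volume (hP k hk).inv _⟩
  have hlaw : ∀ k ≤ T, stateLaw A B Sini π k = multivariateGaussian 0 (X k) := by
    intro k hk
    induction k with
    | zero => rw [hX0]; rfl
    | succ k ih =>
      rw [stateLaw, ih (Nat.le_of_lt hk), hXstep k hk]
      exact map_step_gaussKernel (hXp k (Nat.le_of_lt hk)).posSemidef (hP k hk).inv.posSemidef _ _ _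
  have hfeas : IsFeasible T A B Sini Sfin π := ⟨hpol, by rw [hlaw T le_rfl, hXT]⟩
  have hpot : ∀ k < T, ∃ c, HasPotential (A k) (B k) (gaussianPrior Sρ k) (π k)
      (Q (k + 1))⁻¹ (Q k)⁻¹ c := fun k hk =>
    hasPotential_gaussKernel (hU (k + 1) hk) (hS (k + 1) hk) (hU k hk.le) (hA k hk) (hSρ k hk)
      (hP k hk) (hM k hk)
  have hfin : cost T A B Sini (gaussianPrior Sρ) π ≠ ∞ := by
    rw [cost_eq_sum, ENNReal.sum_ne_top]
    intro k hk
    have hk' := Finset.mem_range.1 hk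
    obtain ⟨c, g, g₀, hg, hρg, hg₀, hκg, hd⟩ := hpot k hk'
    have := hρ k hk'
    rw [hlaw k hk'.le]
    exact stageCost_ne_top IsGaussian.memLp_two_id hg hρg hg₀ hκg hd (memLp_snd_gaussKernel _ _ _)
  choose! c hc using hpot
  obtain ⟨hopt, huniq⟩ := isOptimal_of_hasPotential (P := fun k => (Q k)⁻¹) hρ hc hfeas hfin
  refine ⟨π, fun k _ x => gaussKernel_apply _ _ x, hopt, hfin, fun π' hπ' k hk => ?_⟩
  have hae := huniq π' hπ'
  have hk' := hae k hk
  rw [stateLaw_congr hπ'.1.1 hpol hae hk.le, hlaw k hk.le] at hk'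
  -- Null sets of the nondegenerate Gaussian state law are Lebesgue-null.
  exact (volume_absolutelyContinuous_multivariateGaussian (hXp k hk.le) 0).ae_le hk'
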